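/- Let $0<T_{\min}<T_{\max}$, $A\in\mathbb R^{n\times n}$, $B\in\mathbb R^{n\times p}$, $C_J\in\mathbb R^{q\times n}$, put $\hat A=\begin{pmatrix}A&B\\0&0\end{pmatrix}\in\mathbb R^{(n+p)\times(n+p)}$, and let $V_J$ be a matrix whose columns form a basis of $\ker(C_J)$. For sampling instants $0=t_0<t_1<\dots$ with $t_k-t_{k-1}\in[T_{\min},T_{\max}]$ and the clock $\theta(t)=t-t_k$ on $[t_k,t_{k+1})$, consider the sampled-data system $\dot x=Ax+Bu$, $y_J(k)=C_Jx(t_k^-)$, $u$ constant on each $[t_k,t_{k+1})$, rewritten as the impulsive system with state $z=(x,u)$ $$\begin{pmatrix}\dot z(t)\\ y(t)\end{pmatrix}=\begin{pmatrix}\hat A&0\\0&0\end{pmatrix}\begin{pmatrix}z(t)\\ \hat u(t)\end{pmatrix},\qquad \begin{pmatrix}z(t_k)\\ y_J(k)\end{pmatrix}=\begin{pmatrix}\hat A_J&\hat B_J\\ \hat C_J&0\end{pmatrix}\begin{pmatrix}z(t_k^-)\\ u_J(k)\end{pmatrix},$$ $$\hat A_J=\begin{pmatrix}I&0\\0&0\end{pmatrix},\quad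 \hat B_J=\begin{pmatrix}0\\ I\end{pmatrix},\quad \hat C_J=\begin{pmatrix}C_J&0\end{pmatrix}$$ (with $\hat u$ and $y$ of any dimensions). A controller of order $n_c\in\mathbb N_0$ is $$\begin{pmatrix}\dot x_c(t)\\ \hat u(t)\end{pmatrix}=\begin{pmatrix}A^c&B^c\\C^c&D^c\end{pmatrix}(\theta(t))\begin{pmatrix}x_c(t)\\ y(t)\end{pmatrix},\qquad \begin{pmatrix}x_c(t_k)\\ u_J(k)\end{pmatrix}=\begin{pmatrix}A_J^c&B_J^c\\C_J^c&D_J^c\end{pmatrix}(\theta(t_k^-))\begin{pmatrix}x_c(t_k^-)\\ y_J(k)\end{pmatrix}$$ with the first four maps continuous on $[0,T_{\max}]$ and the last four continuous on $[T_{\min},T_{\max}]$. The closed loop with state $(z,x_c)$ has the flow matrix $\mathcal A(\tau)=\begin{pmatrix}\hat A&0\\0&A^c(\tau)\end{pmatrix}$ and the jump matrix $\mathcal A_J(\tau)=\begin{pmatrix}\hat A_J+\hat B_JD_J^c(\tau)\hat C_J&\hat B_JC_J^c(\tau)\\ B_J^c(\tau)\hat C_J&A_J^c(\tau)\end{pmatrix}$.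 Then the following are equivalent. (i) There are a controller of this form, of some order $n_c$, and a continuously differentiable symmetric-matrix-valued $\mathcal X$ on $[0,T_{\max}]$ with $\mathcal X(\tau)\succ0$ and $$\begin{pmatrix}I\\ \mathcal A(\tau)\end{pmatrix}^T\begin{pmatrix}\dot{\mathcal X}(\tau)&\mathcal X(\tau)\\ \mathcal X(\tau)&0\end{pmatrix}\begin{pmatrix}I\\ \mathcal A(\tau)\end{pmatrix}\prec0\quad\text{for all }\tau\in[0,T_{\max}],$$ $$\begin{pmatrix}I\\ \mathcal A_J(\tau)\end{pmatrix}^T\begin{pmatrix}-\mathcal X(\tau)&0\\0&\mathcal X(0)\end{pmatrix}\begin{pmatrix}I\\ \mathcal A_J(\tau)\end{pmatrix}\prec0\quad\text{for all }\tau\in[T_{\min},T_{\max}].$$ (ii) There are continuously differentiable $X,Y$ on $[0,T_{\max}]$ with values in the symmetric $(n+p)\times(n+p)$ matrices and with upper left $n\times n$ blocks $X_1,Y_1$ such that $$\begin{pmatrix}Y(\tau)&I\\I&X(\tau)\end{pmatrix}\succ0,\qquad \begin{pmatrix}I\\ \hat A\end{pmatrix}^T\begin{pmatrix}\dot X(\tau)&X(\tau)\\X(\tau)&0\end{pmatrix}\begin{pmatrix}I\\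 \hat A\end{pmatrix}\prec0,\qquad \begin{pmatrix}-\hat A^T\\I\end{pmatrix}^T\begin{pmatrix}0&Y(\tau)\\Y(\tau)&\dot Y(\tau)\end{pmatrix}\begin{pmatrix}-\hat A^T\\I\end{pmatrix}\succ0$$ for all $\tau\in[0,T_{\max}]$, and $$\begin{pmatrix}V_J&0\\0&I\end{pmatrix}^T\left(\begin{pmatrix}X_1(0)&0\\0&0\end{pmatrix}-X(\tau)\right)\begin{pmatrix}V_J&0\\0&I\end{pmatrix}\prec0,\qquad Y_1(0)-Y_1(\tau)\succ0$$ for all $\tau\in[T_{\min},T_{\max}]$. -/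

import Mathlib

open Set

namespace ImpulsiveDesign

open Matrix

/-- Negative definiteness `M ≺ 0` of a real matrix (symmetry included). -/
def NegDef {n : Type*} (M : Matrix n n ℝ) : Prop := (-M).PosDef

/-- `X ∈ C¹([0, T], 𝕊ⁿ)`: symmetric-matrix-valued and continuously differentiable on `[0, T]`
(equivalently, all entries are). -/
def IsC1Sym {n : Type*} (T : ℝ) (X : ℝ → Matrix n n ℝ) : Prop :=
  (∀ τ ∈ Icc 0 T, (X τ).IsSymm) ∧ ∀ i j, ContDiffOn ℝ 1 (fun t => X t i j) (Icc 0 T)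

/-- The derivative of a matrix function on `[0, T]`, taken entrywise (one-sided at the end points
`0` and `T`). -/
noncomputable def mderiv {n m : Type*} (T : ℝ) (X : ℝ → Matrix n m ℝ) (τ : ℝ) : Matrix n m ℝ :=
  Matrix.of fun i j => derivWithin (fun t => X t i j) (Icc 0 T) τ

/-- The columns of `V` form a basis of `ker C`. -/
def IsKerBasis {q n r : Type*} [Fintype n] (C : Matrix q n ℝ) (V : Matrix n r ℝ) : Prop :=
  LinearIndependent ℝ V.col ∧ Submodule.span ℝ (range V.col) = LinearMap.ker C.mulVecLin

/-- The flow form `(I; A)ᵀ [[X', X], [X, 0]] (I; A)`, where `X'` stands for the derivative. -/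
def flowForm {n : Type*} [Fintype n] [DecidableEq n] (A X' X : Matrix n n ℝ) : Matrix n n ℝ :=
  (fromRows (1 : Matrix n n ℝ) A)ᵀ * fromBlocks X' X X 0 * fromRows (1 : Matrix n n ℝ) A

/-- The dual flow form `(-Aᵀ; I)ᵀ [[0, Y], [Y, Y']] (-Aᵀ; I)`. -/
def dualFlowForm {n : Type*} [Fintype n] [DecidableEq n] (A Y' Y : Matrix n n ℝ) :
    Matrix n n ℝ :=
  (fromRows (-Aᵀ) (1 : Matrix n n ℝ))ᵀ * fromBlocks 0 Y Y Y' * fromRows (-Aᵀ) (1 : Matrix n n ℝ)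

/-- The jump form `(I; A_J)ᵀ [[-X, 0], [0, X₀]] (I; A_J)`. -/
def jumpForm {n : Type*} [Fintype n] [DecidableEq n] (AJ X X₀ : Matrix n n ℝ) : Matrix n n ℝ :=
  (fromRows (1 : Matrix n n ℝ) AJ)ᵀ * fromBlocks (-X) 0 0 X₀ * fromRows (1 : Matrix n n ℝ) AJ

/-- `X` satisfies the clock-dependent stability LMIs for the impulsive system
`x'(t) = A(θ(t)) x(t)`, `x(t_k) = A_J(θ(t_k⁻)) x(t_k⁻)` under the range dwell-time condition
`t_k - t_{k-1} ∈ [Tmin, Tmax]`. -/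
structure IsCertificate {n : Type*} [Fintype n] [DecidableEq n] (Tmin Tmax : ℝ)
    (A AJ : ℝ → Matrix n n ℝ) (X : ℝ → Matrix n n ℝ) : Prop where
  c1 : IsC1Sym Tmax X
  pos : ∀ τ ∈ Icc 0 Tmax, (X τ).PosDef
  flow : ∀ τ ∈ Icc 0 Tmax, NegDef (flowForm (A τ) (mderiv Tmax X τ) (X τ))
  jump : ∀ τ ∈ Icc Tmin Tmax, NegDef (jumpForm (AJ τ) (X τ) (X 0))

/-- Impulsive open-loop system with state index `n`, flow input/output indices `m`, `l` and jump
input/output indices `mJ`, `lJ`: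
`x' = A x + B u`, `y = C x`, and `x(t_k) = A_J x(t_k⁻) + B_J u_J(k)`, `y_J(k) = C_J x(t_k⁻)`. -/
structure Plant (n m l mJ lJ : Type*) where
  A : Matrix n n ℝ
  B : Matrix n m ℝ
  C : Matrix l n ℝ
  AJ : Matrix n n ℝ
  BJ : Matrix n mJ ℝ
  CJ : Matrix lJ n ℝ

/-- Clock-dependent dynamic output-feedback controller with state index `c`, driven by `(y, y_J)`
and producing `(u, u_J)`:
`x_c' = A(θ) x_c + B(θ) y`, `u = C(θ) x_c + D(θ) y` along the flow, and
`x_c(t_k) = A_J(θ) x_c(t_k⁻) + B_J(θ) y_J(k)`, `u_J(k) = C_J(θ) x_c(t_k⁻) + D_J(θ) y_J(k)`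
with `θ = θ(t_k⁻)` at jumps. Only the values of the flow maps on `[0, Tmax]` and of the jump maps
on `[Tmin, Tmax]` matter. -/
structure Controller (c m l mJ lJ : Type*) where
  A : ℝ → Matrix c c ℝ
  B : ℝ → Matrix c l ℝ
  C : ℝ → Matrix m c ℝ
  D : ℝ → Matrix m l ℝ
  AJ : ℝ → Matrix c c ℝ
  BJ : ℝ → Matrix c lJ ℝ
  CJ : ℝ → Matrix mJ c ℝ
  DJ : ℝ → Matrix mJ lJ ℝ

/-- The controller maps are continuous, the flow maps on `[0, Tmax]` and the jump maps on
`[Tmin, Tmax]`. -/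
structure Controller.IsContinuous {c m l mJ lJ : Type*} (Tmin Tmax : ℝ)
    (K : Controller c m l mJ lJ) : Prop where
  A : ContinuousOn K.A (Icc 0 Tmax)
  B : ContinuousOn K.B (Icc 0 Tmax)
  C : ContinuousOn K.C (Icc 0 Tmax)
  D : ContinuousOn K.D (Icc 0 Tmax)
  AJ : ContinuousOn K.AJ (Icc Tmin Tmax)
  BJ : ContinuousOn K.BJ (Icc Tmin Tmax)
  CJ : ContinuousOn K.CJ (Icc Tmin Tmax)
  DJ : ContinuousOn K.DJ (Icc Tmin Tmax)

section ClosedLoop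

variable {n m l mJ lJ c : Type*} [Fintype n] [Fintype m] [Fintype l] [Fintype mJ] [Fintype lJ]

/-- Flow matrix of the closed loop with state `(x, x_c)`. -/
def clFlow (P : Plant n m l mJ lJ) (K : Controller c m l mJ lJ) (τ : ℝ) :
    Matrix (n ⊕ c) (n ⊕ c) ℝ :=
  fromBlocks (P.A + P.B * K.D τ * P.C) (P.B * K.C τ) (K.B τ * P.C) (K.A τ)

/-- Jump matrix of the closed loop with state `(x, x_c)`. -/
def clJump (P : Plant n m l mJ lJ) (K : Controller c m l mJ lJ) (τ : ℝ) :
    Matrix (n ⊕ c) (n ⊕ c) ℝ :=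
  fromBlocks (P.AJ + P.BJ * K.DJ τ * P.CJ) (P.BJ * K.CJ τ) (K.BJ τ * P.CJ) (K.AJ τ)

end ClosedLoop

/-- There is a controller, of some finite order `nc`, with continuous maps for which the stability
LMIs of the closed loop are feasible. -/
def ExistsCertifiedController {n m l mJ lJ : Type*} [Fintype n] [DecidableEq n] [Fintype m]
    [Fintype l] [Fintype mJ] [Fintype lJ] (Tmin Tmax : ℝ) (P : Plant n m l mJ lJ) : Prop :=
  ∃ (nc : ℕ) (K : Controller (Fin nc) m l mJ lJ), K.IsContinuous Tmin Tmax ∧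
    ∃ X : ℝ → Matrix (n ⊕ Fin nc) (n ⊕ Fin nc) ℝ,
      IsCertificate Tmin Tmax (clFlow P K) (clJump P K) X

/-- The matrix `Â = [[A, B], [0, 0]]`. -/
def hatA {n p : Type*} (A : Matrix n n ℝ) (B : Matrix n p ℝ) : Matrix (n ⊕ p) (n ⊕ p) ℝ :=
  fromBlocks A B 0 0

/-- The sampled-data system `x' = A x + B u`, `y_J(k) = C_J x(t_k⁻)`, with `u` constant between the
sampling instants, as an impulsive system with state `(x, u)`: the flow is `Â`, the flow input
and output are void (zero matrices), and at jumps `x(t_k) = x(t_k⁻)`, `u(t_k) = u_J(k)`. -/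
def sampledDataPlant {n p q : Type*} [DecidableEq n] [DecidableEq p] (m l : Type*)
    (A : Matrix n n ℝ) (B : Matrix n p ℝ) (CJ : Matrix q n ℝ) : Plant (n ⊕ p) m l p q where
  A := hatA A B
  B := 0
  C := 0
  AJ := fromBlocks 1 0 0 0
  BJ := fromRows 0 1
  CJ := fromCols CJ 0

end ImpulsiveDesign

open ImpulsiveDesign Matrix

/-! From (i) to (ii), let Z be a closed-loop certificate. The pair is X = 2 Z₁₁, Y = (Z⁻¹)₁₁. The
controller does not act on z along the flow, so both flow inequalities are compressions of the one
for Z and of its congruence by Z⁻¹. The jump inequality is tested on vectors (v, 0) with Ĉ_J v = 0,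
and its inverse form on (e, 0) with e in the first n coordinates; on these the controller terms
vanish.

From (ii) to (i), the controller has order n + p, and Z = `closedLoopLyapunov X Y` is chosen so that
T = [[1, Y], [0, 1]] gives TᵀZT = [[X, 1], [1, Y]]. After congruence by T the flow form has diagonal
blocks given by the two flow inequalities, and A^c is chosen to cancel the off-diagonal ones
(`negDef_flowForm_closedLoop`).

A Schur complement makes the jump inequality affine in K = T₀ᵀ Z₀ 𝒜_J T, where T₀, Z₀ are the values
at time 0. The parameters in K are then eliminated explicitly: the space splits into P, Q, R such
that the compressions to P ⊕ R and Q ⊕ R do not involve the controller and are positive by (ii),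
while the P-Q block Λ is free. The central completion Λ = Ω_PR Ω_RR⁻¹ Ω_RQ works
(`posDef_jump_linearization`) and is continuous in τ, hence so are the controller maps solved from
it, the divisor 1 - X₀Y₀ being constant and invertible. -/

/-! ### Positive definiteness: congruences, Schur complements, central completion -/

theorem Matrix.PosDef.transpose_mul_mul_of_leftInverse {ι κ : Type*} [Fintype ι] [Fintype κ]
    [DecidableEq κ] {S : Matrix ι ι ℝ} (hS : S.PosDef) {G : Matrix ι κ ℝ} {G' : Matrix κ ι ℝ}
    (hG : G' * G = 1) : (Gᵀ * S * G).PosDef := by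
  rw [← conjTranspose_eq_transpose_of_trivial]
  refine hS.conjTranspose_mul_mul_same fun x y hxy => ?_
  have := congrArg (G' *ᵥ ·) hxy
  simpa [Matrix.mulVec_mulVec, hG] using this

theorem Matrix.PosDef.transpose_eq {ι : Type*} {S : Matrix ι ι ℝ}
    (hS : S.PosDef) : Sᵀ = S := by
  rw [← conjTranspose_eq_transpose_of_trivial]; exact hS.1

theorem Matrix.PosDef.fromBlocks_diagonal {ι κ : Type*} [Fintype ι] [Fintype κ]
    {A : Matrix ι ι ℝ} {D : Matrix κ κ ℝ} (hA : A.PosDef) (hD : D.PosDef) :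
    (fromBlocks A 0 0 D).PosDef := by
  refine .of_dotProduct_mulVec_pos ?_ fun x hx => ?_
  · rw [Matrix.IsHermitian, fromBlocks_conjTranspose, hA.1, hD.1]; simp
  · obtain ⟨u, v, rfl⟩ : ∃ u v, x = Sum.elim u v := ⟨x ∘ Sum.inl, x ∘ Sum.inr, by simp⟩
    have h : star (Sum.elim u v) ⬝ᵥ fromBlocks A 0 0 D *ᵥ Sum.elim u v
        = star u ⬝ᵥ A *ᵥ u + star v ⬝ᵥ D *ᵥ v := by
      simp [fromBlocks_mulVec, sumElim_dotProduct_sumElim]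
    rw [h]
    have hu := hA.posSemidef.dotProduct_mulVec_nonneg u
    have hv := hD.posSemidef.dotProduct_mulVec_nonneg v
    by_cases h0 : u = 0
    · have : v ≠ 0 := by rintro rfl; exact hx (by ext i; cases i <;> simp [h0])
      exact add_pos_of_nonneg_of_pos hu (hD.dotProduct_mulVec_pos this)
    · exact add_pos_of_pos_of_nonneg (hA.dotProduct_mulVec_pos h0) hv

theorem Matrix.PosDef.toBlocks₁₁ {ι κ : Type*} {S : Matrix (ι ⊕ κ) (ι ⊕ κ) ℝ} (hS : S.PosDef) :
    S.toBlocks₁₁.PosDef := hS.submatrix Sum.inl_injective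

theorem Matrix.PosDef.toBlocks₂₂ {ι κ : Type*} {S : Matrix (ι ⊕ κ) (ι ⊕ κ) ℝ} (hS : S.PosDef) :
    S.toBlocks₂₂.PosDef := hS.submatrix Sum.inr_injective

/-- Schur complement with respect to the lower right block. -/
theorem Matrix.posDef_fromBlocks_iff₂₂ {ι κ : Type*} [Fintype ι] [Fintype κ] [DecidableEq ι]
    [DecidableEq κ] {A : Matrix ι ι ℝ} {B : Matrix ι κ ℝ} {D : Matrix κ κ ℝ} (hD : D.PosDef) :
    (fromBlocks A B Bᵀ D).PosDef ↔ (A - B * D⁻¹ * Bᵀ).PosDef := by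
  have hu : IsUnit D.det := (isUnit_iff_isUnit_det D).1 hD.isUnit
  have h₁ : D⁻¹ * D = 1 := nonsing_inv_mul D hu
  have h₂ : D * (D⁻¹ * Bᵀ) = Bᵀ := mul_nonsing_inv_cancel_left D Bᵀ hu
  have hDi := hD.inv.transpose_eq
  have key : fromBlocks A B Bᵀ D = (fromBlocks 1 0 (D⁻¹ * Bᵀ) 1)ᵀ *
      fromBlocks (A - B * D⁻¹ * Bᵀ) 0 0 D * fromBlocks 1 0 (D⁻¹ * Bᵀ) 1 := by
    simp [fromBlocks_transpose, fromBlocks_multiply, hDi, Matrix.mul_assoc, h₁, h₂]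
  constructor
  · intro h
    have h2 := h.transpose_mul_mul_of_leftInverse (G := fromBlocks 1 0 (-(D⁻¹ * Bᵀ)) 1)
      (G' := fromBlocks 1 0 (D⁻¹ * Bᵀ) 1) (by simp [fromBlocks_multiply])
    have : (fromBlocks 1 0 (-(D⁻¹ * Bᵀ)) 1)ᵀ * fromBlocks A B Bᵀ D *
        fromBlocks 1 0 (-(D⁻¹ * Bᵀ)) 1 = fromBlocks (A - B * D⁻¹ * Bᵀ) 0 0 D := by
      simp [fromBlocks_transpose, fromBlocks_multiply, hDi, Matrix.mul_assoc, h₁, h₂, sub_eq_add_neg]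
    rw [this] at h2
    simpa using h2.toBlocks₁₁
  · intro h
    rw [key]
    exact (h.fromBlocks_diagonal hD).transpose_mul_mul_of_leftInverse
      (G' := fromBlocks 1 0 (-(D⁻¹ * Bᵀ)) 1) (by simp [fromBlocks_multiply])

/-- A symmetric matrix is positive definite if its compressions to `P ⊕ R` and to `Q ⊕ R` are, the
three parts span, and the `P`-`Q` block is the central completion. -/
theorem Matrix.posDef_of_central_completion {ι α β ρ : Type*} [Fintype ι] [Fintype α] [Fintype β]
    [Fintype ρ] [DecidableEq ι] [DecidableEq α] [DecidableEq β] [DecidableEq ρ]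
    {Ω : Matrix ι ι ℝ} (hΩ : Ωᵀ = Ω)
    {P : Matrix ι α ℝ} {Q : Matrix ι β ℝ} {R : Matrix ι ρ ℝ}
    {P' : Matrix α ι ℝ} {Q' : Matrix β ι ℝ} {R' : Matrix ρ ι ℝ}
    (hspan : P * P' + Q * Q' + R * R' = 1)
    (hP : (fromBlocks (Pᵀ * Ω * P) (Pᵀ * Ω * R) (Pᵀ * Ω * R)ᵀ (Rᵀ * Ω * R)).PosDef)
    (hQ : (fromBlocks (Qᵀ * Ω * Q) (Qᵀ * Ω * R) (Qᵀ * Ω * R)ᵀ (Rᵀ * Ω * R)).PosDef)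
    (hPQ : Pᵀ * Ω * Q = (Pᵀ * Ω * R) * (Rᵀ * Ω * R)⁻¹ * (Qᵀ * Ω * R)ᵀ) : Ω.PosDef := by
  have hR : (Rᵀ * Ω * R).PosDef := by simpa using hP.toBlocks₂₂
  have hΨ : (fromBlocks (fromBlocks (Pᵀ * Ω * P) (Pᵀ * Ω * Q) (Pᵀ * Ω * Q)ᵀ (Qᵀ * Ω * Q))
      (fromRows (Pᵀ * Ω * R) (Qᵀ * Ω * R)) (fromRows (Pᵀ * Ω * R) (Qᵀ * Ω * R))ᵀ
      (Rᵀ * Ω * R)).PosDef := by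
    -- The central choice of the P-Q block makes the Schur complement of the R block diagonal; its
    -- diagonal blocks are the Schur complements coming from `hP` and `hQ`.
    rw [posDef_fromBlocks_iff₂₂ hR]
    have h := ((posDef_fromBlocks_iff₂₂ hR).1 hP).fromBlocks_diagonal
      ((posDef_fromBlocks_iff₂₂ hR).1 hQ)
    convert h using 1
    have hPQ' := congrArg Matrix.transpose hPQ
    rw [Matrix.transpose_mul _ (Qᵀ * Ω * R)ᵀ, Matrix.transpose_mul _ (Rᵀ * Ω * R)⁻¹,
      hR.inv.transpose_eq, transpose_transpose, ← Matrix.mul_assoc] at hPQ'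
    rw [transpose_fromRows, fromRows_mul, fromRows_mul_fromCols, hPQ', hPQ,
      sub_eq_add_neg, fromBlocks_neg, fromBlocks_add]
    simp [sub_eq_add_neg]
  -- Spanning gives the matrix (P Q R) a right inverse, so positivity of the compression pulls back
  -- to Ω even if the three parts overlap.
  have hHK : fromCols (fromCols P Q) R * fromRows (fromRows P' Q') R' = 1 := by
    rw [fromCols_mul_fromRows, fromCols_mul_fromRows, hspan]
  have h := hΨ.transpose_mul_mul_of_leftInverse hHK
  have hH : fromBlocks (fromBlocks (Pᵀ * Ω * P) (Pᵀ * Ω * Q) (Pᵀ * Ω * Q)ᵀ (Qᵀ * Ω * Q))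
      (fromRows (Pᵀ * Ω * R) (Qᵀ * Ω * R)) (fromRows (Pᵀ * Ω * R) (Qᵀ * Ω * R))ᵀ (Rᵀ * Ω * R)
      = (fromCols (fromCols P Q) R)ᵀ * Ω * fromCols (fromCols P Q) R := by
    simp only [transpose_fromCols, fromRows_mul, transpose_fromRows,
      Matrix.transpose_mul, transpose_transpose, hΩ, mul_fromCols, Matrix.mul_assoc]
    ext ((_ | _) | _) ((_ | _) | _) <;> rfl
  rw [hH] at h
  have hΩ' : (fromRows (fromRows P' Q') R')ᵀ * ((fromCols (fromCols P Q) R)ᵀ * Ω *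
      fromCols (fromCols P Q) R) * fromRows (fromRows P' Q') R'
      = (fromCols (fromCols P Q) R * fromRows (fromRows P' Q') R')ᵀ * Ω *
        (fromCols (fromCols P Q) R * fromRows (fromRows P' Q') R') := by
    simp only [Matrix.transpose_mul, Matrix.mul_assoc]
  rwa [hΩ', hHK, transpose_one, Matrix.one_mul, Matrix.mul_one] at h

/-! ### Elimination of the controller from the linearized jump inequality -/

theorem Matrix.mul_mul_cancel_of_mul_eq_one {α β κ : Type*} [Fintype α] [Fintype β] [DecidableEq α]
    {A : Matrix α β ℝ} {B : Matrix β α ℝ} (h : A * B = 1) (Z : Matrix α κ ℝ) :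
    A * (B * Z) = Z := by
  rw [← Matrix.mul_assoc, h, Matrix.one_mul]

theorem Matrix.mul_mul_eq_zero_of_mul_eq_zero {α β γ κ : Type*} [Fintype β] [Fintype γ]
    {A : Matrix α β ℝ} {B : Matrix β γ ℝ} (h : A * B = 0) (Z : Matrix γ κ ℝ) :
    A * (B * Z) = 0 := by
  rw [← Matrix.mul_assoc, h, Matrix.zero_mul]

theorem Matrix.fromCols_fromRows_zero {α β γ δ : Type*} (A : Matrix α γ ℝ) (B : Matrix β γ ℝ) :
    fromCols (fromRows A B) (0 : Matrix (α ⊕ β) δ ℝ) = fromBlocks A 0 B 0 := by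
  ext (_ | _) (_ | _) <;> rfl

theorem Matrix.fromCols_zero_fromRows {α β γ δ : Type*} (A : Matrix α γ ℝ) (B : Matrix β γ ℝ) :
    fromCols (0 : Matrix (α ⊕ β) δ ℝ) (fromRows A B) = fromBlocks 0 A 0 B := by
  ext (_ | _) (_ | _) <;> rfl

/-- The central completion for the linearized jump inequality. -/
noncomputable def jumpCompletion {ν n p ρ s : Type*} [Fintype ν] [Fintype n] [Fintype ρ]
    [DecidableEq ν] [DecidableEq n] [DecidableEq ρ]
    (E₁ : Matrix ν n ℝ) (E₂ : Matrix ν p ℝ) (V : Matrix ν ρ ℝ) (W : Matrix ν s ℝ)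
    (X Y X₀ Y₀ : Matrix ν ν ℝ) : Matrix (ν ⊕ p) (s ⊕ ν) ℝ :=
  fromBlocks (X₀ * (E₁ * (E₁ᵀ * V))) E₁ 0 (E₂ᵀ * (Y₀ * E₁)) *
    (fromBlocks (Vᵀ * (X * V)) (Vᵀ * E₁) (E₁ᵀ * V) (E₁ᵀ * (Y₀ * E₁)))⁻¹ *
    (fromBlocks (Wᵀ * (X * V)) (Wᵀ * E₁) V (Y * E₁))ᵀ

/-- In K the controller enters only through Λ, and the compressions to P ⊕ R and Q ⊕ R do not see Λ.
They are positive by completing squares against the lower block (`hS₀`, `hV`) and the upper block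
(`hS`, `hY`). The term subtracted from `Λ.toBlocks₁₁` offsets the fixed part of K, so that the P-Q
block is exactly Λ. -/
theorem posDef_jump_linearization {ν n p ρ s q : Type*} [Fintype ν] [Fintype n] [Fintype p]
    [Fintype ρ] [Fintype s] [Fintype q] [DecidableEq ν] [DecidableEq n] [DecidableEq p]
    [DecidableEq ρ] [DecidableEq s]
    {E₁ : Matrix ν n ℝ} {E₂ : Matrix ν p ℝ} {V : Matrix ν ρ ℝ} {U : Matrix ρ ν ℝ}
    {W : Matrix ν s ℝ} {M : Matrix s q ℝ} {C : Matrix q ν ℝ}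
    (h₁₁ : E₁ᵀ * E₁ = 1) (h₂₂ : E₂ᵀ * E₂ = 1) (h₂₁ : E₂ᵀ * E₁ = 0)
    (hE : E₁ * E₁ᵀ + E₂ * E₂ᵀ = 1) (hCV : C * V = 0) (hUV : U * V = 1)
    (hMCW : M * (C * W) = 1) (hVU : V * U + W * (M * C) = 1)
    {X Y X₀ Y₀ : Matrix ν ν ℝ} (hS : (fromBlocks Y 1 1 X).PosDef)
    (hS₀ : (fromBlocks Y₀ 1 1 X₀).PosDef)
    (hV : (Vᵀ * (X - E₁ * (E₁ᵀ * X₀ * E₁) * E₁ᵀ) * V).PosDef)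
    (hY : (E₁ᵀ * (Y₀ - Y) * E₁).PosDef)
    {Λ : Matrix (ν ⊕ p) (s ⊕ ν) ℝ} (hΛ : Λ = jumpCompletion E₁ E₂ V W X Y X₀ Y₀)
    {K : Matrix (ν ⊕ ν) (ν ⊕ ν) ℝ}
    (hK : K = fromBlocks
        (X₀ * (E₁ * E₁ᵀ) + (Λ.toBlocks₁₁ - X₀ * (E₁ * (E₁ᵀ * W))) * (M * C))
        Λ.toBlocks₁₂ (E₁ * E₁ᵀ + E₂ * (Λ.toBlocks₂₁ * (M * C)))
        (E₁ * (E₁ᵀ * Y) + E₂ * Λ.toBlocks₂₂)) :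
    (fromBlocks (fromBlocks X 1 1 Y) Kᵀ K (fromBlocks X₀ 1 1 Y₀)).PosDef := by
  have hX : Xᵀ = X := by simpa using hS.toBlocks₂₂.transpose_eq
  have hYt : Yᵀ = Y := by simpa using hS.toBlocks₁₁.transpose_eq
  have hX₀ : X₀ᵀ = X₀ := by simpa using hS₀.toBlocks₂₂.transpose_eq
  have hY₀ : Y₀ᵀ = Y₀ := by simpa using hS₀.toBlocks₁₁.transpose_eq
  have h₁₂ : E₁ᵀ * E₂ = 0 := by simpa using congrArg Matrix.transpose h₂₁
  have hKV : Kᵀ = fromBlocks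
        ((E₁ * E₁ᵀ) * X₀ + (Cᵀ * Mᵀ) * (Λ.toBlocks₁₁ᵀ - Wᵀ * (E₁ * (E₁ᵀ * X₀))))
        (E₁ * E₁ᵀ + Cᵀ * Mᵀ * Λ.toBlocks₂₁ᵀ * E₂ᵀ) Λ.toBlocks₁₂ᵀ
        (Y * E₁ * E₁ᵀ + Λ.toBlocks₂₂ᵀ * E₂ᵀ) := by
    rw [hK]
    simp [fromBlocks_transpose, hX₀, hYt, Matrix.mul_assoc]
  have hVC : Vᵀ * Cᵀ = 0 := by simpa using congrArg Matrix.transpose hCV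
  have hWM : Wᵀ * (Cᵀ * Mᵀ) = 1 := by
    simpa [Matrix.mul_assoc] using congrArg Matrix.transpose hMCW
  have hUW : U * W = 0 := by
    have h := congrArg (U * · * W) hVU
    simp only [Matrix.mul_add, Matrix.add_mul, Matrix.mul_assoc, hMCW,
      mul_mul_cancel_of_mul_eq_one hUV, Matrix.mul_one] at h
    simpa using h
  have hJV : E₁ᵀ * (E₁ * (E₁ᵀ * V)) = E₁ᵀ * V := mul_mul_cancel_of_mul_eq_one h₁₁ _
  -- P and R together fill the lower half and add V above; Q and R together fill the upper half and
  -- add E₁ below.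
  obtain ⟨P, hP⟩ : ∃ P : Matrix ((ν ⊕ ν) ⊕ (ν ⊕ ν)) (ν ⊕ p) ℝ,
      P = fromRows 0 (fromBlocks 1 0 0 E₂) := ⟨_, rfl⟩
  obtain ⟨Q, hQ⟩ : ∃ Q : Matrix ((ν ⊕ ν) ⊕ (ν ⊕ ν)) (s ⊕ ν) ℝ,
      Q = fromRows (fromBlocks W 0 0 1) 0 := ⟨_, rfl⟩
  obtain ⟨R, hR⟩ : ∃ R : Matrix ((ν ⊕ ν) ⊕ (ν ⊕ ν)) (ρ ⊕ n) ℝ,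
      R = fromRows (fromBlocks V 0 0 0) (fromBlocks 0 0 0 E₁) := ⟨_, rfl⟩
  obtain ⟨Ω, hΩ⟩ : ∃ Ω, Ω = fromBlocks (fromBlocks X 1 1 Y) Kᵀ K (fromBlocks X₀ 1 1 Y₀) :=
    ⟨_, rfl⟩
  rw [← hΩ]
  have hPR : Pᵀ * Ω * R
      = fromBlocks (X₀ * (E₁ * (E₁ᵀ * V))) E₁ 0 (E₂ᵀ * (Y₀ * E₁)) := by
    rw [hΩ, hKV, hK, hP, hR]
    simp [transpose_fromRows, fromCols_mul_fromBlocks, fromCols_mul_fromRows, fromBlocks_transpose,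
      fromBlocks_multiply, fromBlocks_add, Matrix.mul_assoc, Matrix.add_mul, Matrix.mul_add, hCV,
      mul_mul_eq_zero_of_mul_eq_zero h₂₁]
  have hRR : Rᵀ * Ω * R
      = fromBlocks (Vᵀ * (X * V)) (Vᵀ * E₁) (E₁ᵀ * V) (E₁ᵀ * (Y₀ * E₁)) := by
    rw [hΩ, hKV, hK, hR]
    simp [transpose_fromRows, fromCols_mul_fromBlocks, fromCols_mul_fromRows, fromBlocks_transpose,
      fromBlocks_multiply, fromBlocks_add, Matrix.mul_assoc, Matrix.mul_add, h₁₁,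
      mul_mul_eq_zero_of_mul_eq_zero hVC, hJV, mul_mul_eq_zero_of_mul_eq_zero h₁₂]
  have hQR : Qᵀ * Ω * R
      = fromBlocks (Wᵀ * (X * V)) (Wᵀ * E₁) V (Y * E₁) := by
    rw [hΩ, hKV, hK, hQ, hR]
    simp [transpose_fromRows, fromCols_mul_fromBlocks, fromCols_mul_fromRows, fromBlocks_transpose,
      fromBlocks_multiply, fromBlocks_add, Matrix.mul_assoc, Matrix.add_mul, Matrix.mul_add, h₁₁,
      h₂₁]
  have hPQ : Pᵀ * Ω * Q = Λ := by
    rw [hΩ, hKV, hK, hP, hQ]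
    simp [transpose_fromRows, fromCols_mul_fromBlocks, fromCols_mul_fromRows, fromBlocks_transpose,
      fromBlocks_multiply, Matrix.mul_assoc, Matrix.add_mul, Matrix.mul_add,
      mul_mul_eq_zero_of_mul_eq_zero h₂₁, mul_mul_cancel_of_mul_eq_one h₂₂, hMCW]
    exact fromBlocks_toBlocks Λ
  have hPP : Pᵀ * Ω * P = fromBlocks X₀ E₂ E₂ᵀ (E₂ᵀ * (Y₀ * E₂)) := by
    rw [hΩ, hP]
    simp [transpose_fromRows, fromCols_mul_fromBlocks, fromCols_mul_fromRows, fromBlocks_transpose,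
      fromBlocks_multiply, Matrix.mul_assoc]
  have hQQ : Qᵀ * Ω * Q = fromBlocks (Wᵀ * (X * W)) Wᵀ W Y := by
    rw [hΩ, hQ]
    simp [transpose_fromRows, fromCols_mul_fromBlocks, fromCols_mul_fromRows, fromBlocks_transpose,
      fromBlocks_multiply, Matrix.mul_assoc]
  have hS' : (fromBlocks X 1 1 Y).PosDef := by
    simpa using hS.submatrix (e := Sum.swap) Sum.swap_leftInverse.injective
  have hS₀' : (fromBlocks X₀ 1 1 Y₀).PosDef := by
    simpa using hS₀.submatrix (e := Sum.swap) Sum.swap_leftInverse.injective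
  refine posDef_of_central_completion (P := P) (Q := Q) (R := R)
    (P' := fromCols 0 (fromBlocks 1 0 0 E₂ᵀ)) (Q' := fromCols (fromBlocks (M * C) 0 0 1) 0)
    (R' := fromCols (fromBlocks U 0 0 0) (fromBlocks 0 0 0 E₁ᵀ)) ?_ ?_ ?_ ?_ ?_
  · rw [hΩ]
    simp [fromBlocks_transpose, hX, hYt, hX₀, hY₀]
  · rw [hP, hQ, hR]
    simp only [fromRows_mul_fromCols, fromBlocks_multiply]
    simp [fromBlocks_add, add_comm, hVU, hE]
  · rw [hPP, hPR, hRR]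
    -- K maps (V, 0) to [[X₀, 1], [1, Y₀]] (E₁E₁ᵀV, 0), so the shift by E₁E₁ᵀV completes the square
    -- and leaves the form of `hV`.
    have h := (hS₀'.fromBlocks_diagonal hV).transpose_mul_mul_of_leftInverse
      (G := fromBlocks (fromBlocks 1 0 0 E₂) (fromBlocks (E₁ * (E₁ᵀ * V)) 0 0 E₁) 0
        (fromCols 1 0))
      (G' := fromBlocks (fromBlocks 1 0 0 E₂ᵀ) (fromRows (-(E₁ * (E₁ᵀ * V))) 0)
        (fromBlocks 0 0 0 E₁ᵀ) (fromRows 1 0)) (by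
        simp [fromBlocks_multiply, fromBlocks_add, fromCols_fromRows_zero, h₁₁, h₁₂, h₂₂, h₂₁])
    convert h using 1
    simp [fromBlocks_transpose, fromBlocks_multiply, transpose_fromCols,
      fromCols_fromRows_zero, fromRows_mul, Matrix.mul_assoc, hX₀, hY₀, Matrix.mul_sub,
      Matrix.sub_mul, mul_mul_eq_zero_of_mul_eq_zero h₂₁, hJV, h₁₁, h₁₂]
    simp [sub_eq_add_neg, fromBlocks_neg, fromBlocks_add]
  · rw [hQQ, hQR, hRR]
    -- Dually, Kᵀ maps (0, E₁) to [[X, 1], [1, Y]] (0, E₁), and completing the square leaves the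
    -- form of `hY`.
    have h := (hS'.fromBlocks_diagonal hY).transpose_mul_mul_of_leftInverse
      (G := fromBlocks (fromBlocks W 0 0 1) (fromBlocks V 0 0 E₁) 0 (fromCols 0 1))
      (G' := fromBlocks (fromBlocks (M * C) 0 0 1) (fromRows 0 (-E₁))
        (fromBlocks U 0 0 0) (fromRows 0 1)) (by
        simp [fromBlocks_multiply, fromBlocks_add, fromCols_zero_fromRows, Matrix.mul_assoc, hMCW,
        hCV, hUW, hUV])
    convert h using 1
    simp [fromBlocks_transpose, fromBlocks_multiply, transpose_fromCols,
      fromCols_zero_fromRows, fromRows_mul, Matrix.mul_assoc, hX, hYt, Matrix.mul_sub,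
      Matrix.sub_mul]
    simp [sub_eq_add_neg, fromBlocks_neg, fromBlocks_add]
  · rw [hPQ, hPR, hRR, hQR, hΛ, jumpCompletion]

/-- This is the R block, inverted in `jumpCompletion`; its invertibility yields continuity of the
completion. It splits as a compression of [[X, 1], [1, Y]] plus E₁ᵀ(Y₀ - Y)E₁ in the last block. -/
theorem posDef_jumpCompletion_pivot {ν n ρ : Type*} [Fintype ν] [Fintype n]
    [Fintype ρ] [DecidableEq ν] [DecidableEq n] [DecidableEq ρ]
    {E₁ : Matrix ν n ℝ} {V : Matrix ν ρ ℝ} {U : Matrix ρ ν ℝ} (hUV : U * V = 1)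
    {X Y Y₀ : Matrix ν ν ℝ} (hS : (fromBlocks Y 1 1 X).PosDef)
    (hY : (E₁ᵀ * (Y₀ - Y) * E₁).PosDef) :
    (fromBlocks (Vᵀ * (X * V)) (Vᵀ * E₁) (E₁ᵀ * V) (E₁ᵀ * (Y₀ * E₁))).PosDef := by
  have hS' : (fromBlocks X 1 1 Y).PosDef := by
    simpa using hS.submatrix (e := Sum.swap) Sum.swap_leftInverse.injective
  have h := (hS'.fromBlocks_diagonal hY).transpose_mul_mul_of_leftInverse
    (G := fromRows (fromBlocks V 0 0 E₁) (fromCols 0 1))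
    (G' := fromCols (fromBlocks U 0 0 0) (fromRows 0 1)) (by
      simp [fromBlocks_multiply, fromCols_mul_fromRows, fromCols_zero_fromRows, fromBlocks_add,
        hUV])
  convert h using 1
  simp [fromBlocks_transpose, fromBlocks_multiply, transpose_fromRows, transpose_fromCols,
    fromCols_mul_fromBlocks, fromCols_mul_fromRows, fromCols_zero_fromRows, fromRows_mul,
    Matrix.mul_assoc, Matrix.mul_sub, Matrix.sub_mul]
  simp [sub_eq_add_neg, fromBlocks_neg, fromBlocks_add]

theorem Continuous.matrix_inv_of_isUnit {T ι : Type*} [TopologicalSpace T] [Fintype ι]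
    [DecidableEq ι] {A : T → Matrix ι ι ℝ} (hA : Continuous A) (hu : ∀ t, IsUnit (A t)) :
    Continuous fun t => (A t)⁻¹ := by
  refine continuous_iff_continuousAt.2 fun t => ?_
  refine ContinuousAt.comp (f := A) (g := Inv.inv) ?_ hA.continuousAt
  refine continuousAt_matrix_inv _ ?_
  rw [Ring.inverse_eq_inv']
  exact continuousAt_inv₀ ((isUnit_iff_isUnit_det _).1 (hu t)).ne_zero

theorem continuous_jumpCompletion {T ν n p ρ s : Type*} [TopologicalSpace T] [Fintype ν]
    [Fintype n] [Fintype ρ] [DecidableEq ν] [DecidableEq n] [DecidableEq ρ]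
    (E₁ : Matrix ν n ℝ) (E₂ : Matrix ν p ℝ) (V : Matrix ν ρ ℝ) (W : Matrix ν s ℝ)
    {X Y : T → Matrix ν ν ℝ} (X₀ Y₀ : Matrix ν ν ℝ) (hX : Continuous X) (hY : Continuous Y)
    (hu : ∀ t, IsUnit (fromBlocks (Vᵀ * (X t * V)) (Vᵀ * E₁) (E₁ᵀ * V) (E₁ᵀ * (Y₀ * E₁)))) :
    Continuous fun t => jumpCompletion E₁ E₂ V W (X t) (Y t) X₀ Y₀ := by
  unfold jumpCompletion
  refine (continuous_const.matrix_mul (Continuous.matrix_inv_of_isUnit ?_ hu)).matrix_mul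
    (Continuous.matrix_transpose ?_)
  · exact (continuous_const.matrix_mul (hX.matrix_mul continuous_const)).matrix_fromBlocks
      continuous_const continuous_const continuous_const
  · exact (continuous_const.matrix_mul (hX.matrix_mul continuous_const)).matrix_fromBlocks
      continuous_const continuous_const (hY.matrix_mul continuous_const)

/-! ### The closed-loop Lyapunov matrix and its linearizing congruence -/

/-- The coupling inequality says X - Y⁻¹ ≻ 0, and 1 - XY = -(X - Y⁻¹)Y is a product of invertible
matrices. -/
theorem isUnit_one_sub_mul {ν : Type*} [Fintype ν] [DecidableEq ν] {X Y : Matrix ν ν ℝ}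
    (hS : (fromBlocks Y 1 1 X).PosDef) : IsUnit (1 - X * Y) := by
  have hS' : (fromBlocks X 1 1ᵀ Y).PosDef := by
    simpa using hS.submatrix (e := Sum.swap) Sum.swap_leftInverse.injective
  have hY : Y.PosDef := by simpa using hS.toBlocks₁₁
  have h := ((posDef_fromBlocks_iff₂₂ hY).1 hS').isUnit
  have hu : Y⁻¹ * Y = 1 := nonsing_inv_mul Y ((isUnit_iff_isUnit_det Y).1 hY.isUnit)
  have : 1 - X * Y = -(X - 1 * Y⁻¹ * 1ᵀ) * Y := by
    simp [Matrix.sub_mul, hu]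
  rw [this]
  exact h.neg.mul hY.isUnit

/-- The closed-loop certificate assembled from the pair `(X, Y)`. -/
def closedLoopLyapunov {ν : Type*} [Fintype ν] [DecidableEq ν] (X Y : Matrix ν ν ℝ) :
    Matrix (ν ⊕ ν) (ν ⊕ ν) ℝ :=
  fromBlocks X (1 - X * Y) (1 - Y * X) (Y * X * Y - Y)

theorem closedLoopLyapunov_transpose {ν : Type*} [Fintype ν] [DecidableEq ν] {X Y : Matrix ν ν ℝ}
    (hX : Xᵀ = X) (hY : Yᵀ = Y) : (closedLoopLyapunov X Y)ᵀ = closedLoopLyapunov X Y := by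
  simp [closedLoopLyapunov, fromBlocks_transpose, hX, hY, Matrix.mul_assoc]

theorem transpose_mul_closedLoopLyapunov {ν : Type*} [Fintype ν] [DecidableEq ν]
    {X Y : Matrix ν ν ℝ} (hY : Yᵀ = Y) :
    (fromBlocks 1 Y 0 1)ᵀ * closedLoopLyapunov X Y = fromBlocks X (1 - X * Y) 1 0 := by
  simp only [closedLoopLyapunov, fromBlocks_transpose, fromBlocks_multiply, hY]
  congr 1 <;> simp
  noncomm_ring

theorem transpose_mul_closedLoopLyapunov_mul {ν : Type*} [Fintype ν] [DecidableEq ν]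
    {X Y : Matrix ν ν ℝ} (hY : Yᵀ = Y) :
    (fromBlocks 1 Y 0 1)ᵀ * closedLoopLyapunov X Y * fromBlocks 1 Y 0 1 = fromBlocks X 1 1 Y := by
  rw [transpose_mul_closedLoopLyapunov hY]
  simp [fromBlocks_multiply]

theorem posDef_closedLoopLyapunov {ν : Type*} [Fintype ν] [DecidableEq ν] {X Y : Matrix ν ν ℝ}
    (hS : (fromBlocks Y 1 1 X).PosDef) : (closedLoopLyapunov X Y).PosDef := by
  have hS' : (fromBlocks X 1 1 Y).PosDef := by
    simpa using hS.submatrix (e := Sum.swap) Sum.swap_leftInverse.injective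
  have hY : Yᵀ = Y := by simpa using hS.toBlocks₁₁.transpose_eq
  have h₁ : fromBlocks 1 Y 0 1 * fromBlocks 1 (-Y) 0 1 = (1 : Matrix (ν ⊕ ν) (ν ⊕ ν) ℝ) := by
    simp [fromBlocks_multiply]
  have h := hS'.transpose_mul_mul_of_leftInverse h₁
  rw [← transpose_mul_closedLoopLyapunov_mul hY] at h
  have h₂ := congrArg Matrix.transpose h₁
  rw [Matrix.transpose_mul, transpose_one] at h₂
  rwa [Matrix.mul_assoc, Matrix.mul_assoc, h₁, Matrix.mul_one, ← Matrix.mul_assoc, h₂,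
    Matrix.one_mul] at h

/-- Recover the jump inequality from its linearization. -/
theorem posDef_sub_of_linearization {ι : Type*} [Fintype ι] [DecidableEq ι]
    {Z Z₀ A K T T' T₀ T₀' : Matrix ι ι ℝ} (hT : T * T' = 1) (hT₀ : T₀ * T₀' = 1)
    (hZ₀ : Z₀ᵀ = Z₀) (hK : K = T₀ᵀ * Z₀ * A * T)
    (h : (fromBlocks (Tᵀ * Z * T) Kᵀ K (T₀ᵀ * Z₀ * T₀)).PosDef) : (Z - Aᵀ * Z₀ * A).PosDef := by
  -- Undoing T and T₀ and testing on the graph of -A gives Z - 2AᵀZ₀A + AᵀZ₀A.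
  have h₁ := h.transpose_mul_mul_of_leftInverse (G := fromRows T' (-(T₀' * A)))
    (G' := fromCols T 0) (by rw [fromCols_mul_fromRows]; simpa using hT)
  have e₁ : T'ᵀ * Tᵀ = 1 := by rw [← Matrix.transpose_mul, hT, transpose_one]
  have e₂ : T₀'ᵀ * T₀ᵀ = 1 := by rw [← Matrix.transpose_mul, hT₀, transpose_one]
  convert h₁ using 1
  simp [transpose_fromRows, fromCols_mul_fromBlocks, fromCols_mul_fromRows, hK, hZ₀,
    Matrix.mul_assoc, Matrix.add_mul, hT, mul_mul_cancel_of_mul_eq_one e₁,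
    mul_mul_cancel_of_mul_eq_one e₂, sub_eq_add_neg]

theorem flowForm_eq {ν : Type*} [Fintype ν] [DecidableEq ν] (A X' X : Matrix ν ν ℝ) :
    flowForm A X' X = X' + Aᵀ * X + X * A := by
  simp [flowForm, transpose_fromRows, fromCols_mul_fromBlocks, fromCols_mul_fromRows]

theorem dualFlowForm_eq {ν : Type*} [Fintype ν] [DecidableEq ν] (A Y' Y : Matrix ν ν ℝ) :
    dualFlowForm A Y' Y = Y' - A * Y - Y * Aᵀ := by
  simp [dualFlowForm, transpose_fromRows, fromCols_mul_fromBlocks, fromCols_mul_fromRows]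
  abel

theorem jumpForm_eq {ν : Type*} [Fintype ν] [DecidableEq ν] (A X X₀ : Matrix ν ν ℝ) :
    jumpForm A X X₀ = -(X - Aᵀ * X₀ * A) := by
  simp [jumpForm, transpose_fromRows, fromCols_mul_fromBlocks, fromCols_mul_fromRows]
  abel

theorem negDef_jumpForm_iff {ν : Type*} [Fintype ν] [DecidableEq ν] (A X X₀ : Matrix ν ν ℝ) :
    NegDef (jumpForm A X X₀) ↔ (X - Aᵀ * X₀ * A).PosDef := by
  rw [NegDef, jumpForm_eq, neg_neg]

/-- Congruence by T turns the form into diag(flow form of X, minus dual flow form of Y): `hAc` is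
exactly the vanishing of the off-diagonal blocks. The large block matrix is the product-rule
derivative of `closedLoopLyapunov`. -/
theorem negDef_flowForm_closedLoop {ν : Type*} [Fintype ν] [DecidableEq ν]
    {A X X' Y Y' Ac : Matrix ν ν ℝ} (hX : Xᵀ = X) (hY : Yᵀ = Y) (hY' : Y'ᵀ = Y')
    (hfX : NegDef (flowForm A X' X)) (hfY : (dualFlowForm A Y' Y).PosDef)
    (hAc : (1 - X * Y) * Ac = X * Y' - X * A * Y - Aᵀ) :
    NegDef (flowForm (fromBlocks A 0 0 Ac)
      (fromBlocks X' (-(X' * Y + X * Y')) (-(Y' * X + Y * X'))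
        (Y' * X * Y + Y * X' * Y + Y * X * Y' - Y')) (closedLoopLyapunov X Y)) := by
  have hAct : Acᵀ * (1 - Y * X) = Y' * X - Y * Aᵀ * X - A := by
    have h := congrArg Matrix.transpose hAc
    simpa [hX, hY, hY', Matrix.mul_assoc] using h
  have hAcY : Y * (1 - X * Y) * Ac = Y * (X * Y' - X * A * Y - Aᵀ) := by
    rw [Matrix.mul_assoc, hAc]
  have hActY : Acᵀ * (1 - Y * X) * Y = (Y' * X - Y * Aᵀ * X - A) * Y := by
    rw [hAct]
  have hd := Matrix.PosDef.fromBlocks_diagonal hfX hfY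
  have h := hd.transpose_mul_mul_of_leftInverse (G := fromBlocks 1 (-Y) 0 1)
    (G' := fromBlocks 1 Y 0 1) (by simp [fromBlocks_multiply])
  rw [NegDef]
  convert h using 1
  rw [flowForm_eq, flowForm_eq, dualFlowForm_eq, closedLoopLyapunov]
  simp only [fromBlocks_transpose, fromBlocks_multiply, fromBlocks_add, fromBlocks_neg,
    transpose_neg, transpose_one, transpose_zero, hY]
  congr 1
  · noncomm_ring
  · simp only [Matrix.zero_mul, Matrix.mul_zero, zero_add, add_zero, hAc]
    noncomm_ring
  · simp only [Matrix.zero_mul, Matrix.mul_zero, zero_add, add_zero, hAct]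
    noncomm_ring
  · have e₁ : (Y * X * Y - Y) * Ac = -(Y * (1 - X * Y) * Ac) := by noncomm_ring
    have e₂ : Acᵀ * (Y * X * Y - Y) = -(Acᵀ * (1 - Y * X) * Y) := by noncomm_ring
    simp only [Matrix.zero_mul, Matrix.mul_zero, zero_add, add_zero, e₁, e₂, hAcY, hActY]
    noncomm_ring

/-! ### Controller jump maps recovered from the completion -/

section Jump

variable {ν n p s q : Type*} [Fintype ν] [Fintype n] [Fintype p] [Fintype s] [Fintype q]
  [DecidableEq ν]

/-- Controller jump input matrix recovered from the completion `Λ`. -/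
noncomputable def jumpB (E₁ : Matrix ν n ℝ) (E₂ : Matrix ν p ℝ) (W : Matrix ν s ℝ)
    (M : Matrix s q ℝ) (X₀ Y₀ : Matrix ν ν ℝ) (Λ : Matrix (ν ⊕ p) (s ⊕ ν) ℝ) : Matrix ν q ℝ :=
  (1 - X₀ * Y₀)⁻¹ * ((Λ.toBlocks₁₁ - X₀ * (E₁ * (E₁ᵀ * W))) * M - X₀ * (E₂ * (Λ.toBlocks₂₁ * M)))

/-- Controller jump state matrix recovered from the completion `Λ`. -/
noncomputable def jumpA (E₁ : Matrix ν n ℝ) (E₂ : Matrix ν p ℝ) (W : Matrix ν s ℝ)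
    (M : Matrix s q ℝ) (C : Matrix q ν ℝ) (Y X₀ Y₀ : Matrix ν ν ℝ)
    (Λ : Matrix (ν ⊕ p) (s ⊕ ν) ℝ) : Matrix ν ν ℝ :=
  (1 - X₀ * Y₀)⁻¹ * (Λ.toBlocks₁₂ - X₀ * (E₁ * (E₁ᵀ * Y) + E₂ * Λ.toBlocks₂₂)) -
    jumpB E₁ E₂ W M X₀ Y₀ Λ * (C * Y)

/-- Controller jump output matrix recovered from the completion `Λ`. -/
def jumpC (M : Matrix s q ℝ) (C : Matrix q ν ℝ) (Y : Matrix ν ν ℝ)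
    (Λ : Matrix (ν ⊕ p) (s ⊕ ν) ℝ) : Matrix p ν ℝ :=
  Λ.toBlocks₂₂ - Λ.toBlocks₂₁ * M * (C * Y)

/-- Since T₀ᵀZ₀ = [[X₀, 1 - X₀Y₀], [1, 0]], the equation T₀ᵀZ₀AT = K is triangular in the unknowns:
the lower row fixes D and C, then the upper row fixes B and A after division by 1 - X₀Y₀. The
controller's D is Λ₂₁M. -/
theorem posDef_closedLoop_jump {ρ : Type*} [Fintype ρ] [DecidableEq n] [DecidableEq p]
    [DecidableEq ρ] [DecidableEq s]
    {E₁ : Matrix ν n ℝ} {E₂ : Matrix ν p ℝ} {V : Matrix ν ρ ℝ} {U : Matrix ρ ν ℝ}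
    {W : Matrix ν s ℝ} {M : Matrix s q ℝ} {C : Matrix q ν ℝ}
    (h₁₁ : E₁ᵀ * E₁ = 1) (h₂₂ : E₂ᵀ * E₂ = 1) (h₂₁ : E₂ᵀ * E₁ = 0)
    (hE : E₁ * E₁ᵀ + E₂ * E₂ᵀ = 1) (hCV : C * V = 0) (hUV : U * V = 1)
    (hMCW : M * (C * W) = 1) (hVU : V * U + W * (M * C) = 1)
    {X Y X₀ Y₀ : Matrix ν ν ℝ} (hS : (fromBlocks Y 1 1 X).PosDef)
    (hS₀ : (fromBlocks Y₀ 1 1 X₀).PosDef)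
    (hV : (Vᵀ * (X - E₁ * (E₁ᵀ * X₀ * E₁) * E₁ᵀ) * V).PosDef)
    (hY : (E₁ᵀ * (Y₀ - Y) * E₁).PosDef)
    {Λ : Matrix (ν ⊕ p) (s ⊕ ν) ℝ} (hΛ : Λ = jumpCompletion E₁ E₂ V W X Y X₀ Y₀)
    {A : Matrix (ν ⊕ ν) (ν ⊕ ν) ℝ}
    (hA : A = fromBlocks (E₁ * E₁ᵀ + E₂ * (Λ.toBlocks₂₁ * M) * C) (E₂ * jumpC M C Y Λ)
      (jumpB E₁ E₂ W M X₀ Y₀ Λ * C) (jumpA E₁ E₂ W M C Y X₀ Y₀ Λ)) :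
    (closedLoopLyapunov X Y - Aᵀ * closedLoopLyapunov X₀ Y₀ * A).PosDef := by
  have hX₀t : X₀ᵀ = X₀ := by simpa using hS₀.toBlocks₂₂.transpose_eq
  have hY₀t : Y₀ᵀ = Y₀ := by simpa using hS₀.toBlocks₁₁.transpose_eq
  have hYt : Yᵀ = Y := by simpa using hS.toBlocks₁₁.transpose_eq
  have hZ : (1 - X₀ * Y₀) * (1 - X₀ * Y₀)⁻¹ = 1 :=
    mul_nonsing_inv _ ((isUnit_iff_isUnit_det _).1 (isUnit_one_sub_mul hS₀))
  refine posDef_sub_of_linearization (T := fromBlocks 1 Y 0 1) (T' := fromBlocks 1 (-Y) 0 1)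
    (T₀ := fromBlocks 1 Y₀ 0 1) (T₀' := fromBlocks 1 (-Y₀) 0 1) (by simp [fromBlocks_multiply])
    (by simp [fromBlocks_multiply]) (closedLoopLyapunov_transpose hX₀t hY₀t) rfl ?_
  rw [transpose_mul_closedLoopLyapunov_mul hYt, transpose_mul_closedLoopLyapunov_mul hY₀t]
  refine posDef_jump_linearization h₁₁ h₂₂ h₂₁ hE hCV hUV hMCW hVU hS hS₀ hV hY hΛ ?_
  rw [transpose_mul_closedLoopLyapunov hY₀t, hA]
  obtain ⟨Z, hZdef⟩ : ∃ Z, Z = 1 - X₀ * Y₀ := ⟨_, rfl⟩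
  rw [← hZdef] at hZ
  have hB : Z * jumpB E₁ E₂ W M X₀ Y₀ Λ =
      (Λ.toBlocks₁₁ - X₀ * (E₁ * (E₁ᵀ * W))) * M - X₀ * (E₂ * (Λ.toBlocks₂₁ * M)) := by
    rw [jumpB, ← hZdef, mul_mul_cancel_of_mul_eq_one hZ]
  have hAc : Z * jumpA E₁ E₂ W M C Y X₀ Y₀ Λ =
      Λ.toBlocks₁₂ - X₀ * (E₁ * (E₁ᵀ * Y) + E₂ * Λ.toBlocks₂₂) -
        Z * jumpB E₁ E₂ W M X₀ Y₀ Λ * (C * Y) := by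
    rw [jumpA, ← hZdef, Matrix.mul_sub, mul_mul_cancel_of_mul_eq_one hZ, Matrix.mul_assoc]
  rw [← hZdef, fromBlocks_multiply, fromBlocks_multiply, ← Matrix.mul_assoc Z, hAc, hB, jumpC]
  congr 1 <;>
  · simp only [Matrix.mul_add, Matrix.mul_sub, Matrix.add_mul, Matrix.sub_mul, Matrix.mul_assoc,
      Matrix.mul_one, Matrix.mul_zero, Matrix.one_mul, Matrix.zero_mul]
    abel

theorem continuous_jump_maps {T : Type*} [TopologicalSpace T]
    (E₁ : Matrix ν n ℝ) (E₂ : Matrix ν p ℝ) (W : Matrix ν s ℝ) (M : Matrix s q ℝ)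
    (C : Matrix q ν ℝ) (X₀ Y₀ : Matrix ν ν ℝ) {Y : T → Matrix ν ν ℝ}
    {Λ : T → Matrix (ν ⊕ p) (s ⊕ ν) ℝ} (hY : Continuous Y) (hΛ : Continuous Λ) :
    Continuous (fun t => jumpA E₁ E₂ W M C (Y t) X₀ Y₀ (Λ t)) ∧
    Continuous (fun t => jumpB E₁ E₂ W M X₀ Y₀ (Λ t)) ∧
    Continuous (fun t => jumpC M C (Y t) (Λ t)) ∧
    Continuous (fun t => (Λ t).toBlocks₂₁ * M) := by
  have h₁₁ : Continuous fun t => (Λ t).toBlocks₁₁ := hΛ.matrix_submatrix Sum.inl Sum.inl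
  have h₁₂ : Continuous fun t => (Λ t).toBlocks₁₂ := hΛ.matrix_submatrix Sum.inl Sum.inr
  have h₂₁ : Continuous fun t => (Λ t).toBlocks₂₁ := hΛ.matrix_submatrix Sum.inr Sum.inl
  have h₂₂ : Continuous fun t => (Λ t).toBlocks₂₂ := hΛ.matrix_submatrix Sum.inr Sum.inr
  unfold jumpA jumpB jumpC
  refine ⟨?_, ?_, ?_, ?_⟩ <;> fun_prop

end Jump

/-- The columns of W form a basis of a complement of ker C. There C is injective, so CW has a left
inverse M, and WMC is the projection onto the complement along the kernel. -/
theorem exists_kernel_complement {n q r : ℕ} {C : Matrix (Fin q) (Fin n) ℝ}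
    {V : Matrix (Fin n) (Fin r) ℝ} (hV : IsKerBasis C V) :
    ∃ (s : ℕ) (W : Matrix (Fin n) (Fin s) ℝ) (M : Matrix (Fin s) (Fin q) ℝ)
      (U : Matrix (Fin r) (Fin n) ℝ), C * V = 0 ∧ M * (C * W) = 1 ∧ V * U + W * (M * C) = 1 ∧
        U * V = 1 := by
  have hker : LinearMap.range V.mulVecLin = LinearMap.ker C.mulVecLin := by
    rw [range_mulVecLin, hV.2]
  obtain ⟨Q, hQ⟩ := Submodule.exists_isCompl (LinearMap.ker C.mulVecLin)
  let b := Module.finBasis ℝ Q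
  let W : Matrix (Fin n) (Fin (Module.finrank ℝ Q)) ℝ := Matrix.of fun i j => (b j : Fin n → ℝ) i
  have hWv : ∀ x, W *ᵥ x = ((∑ j, x j • b j : Q) : Fin n → ℝ) := by
    intro x
    ext i
    simp [W, mulVec, dotProduct, mul_comm]
  have hinj : Function.Injective (C * W).mulVecLin := by
    rw [← LinearMap.ker_eq_bot, LinearMap.ker_eq_bot']
    intro x hx
    have h₁ : W *ᵥ x ∈ LinearMap.ker C.mulVecLin := by simpa [mulVec_mulVec] using hx
    have h₂ : W *ᵥ x ∈ Q := by rw [hWv]; exact Subtype.coe_prop _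
    have h₃ := (Submodule.disjoint_def.1 hQ.disjoint) _ h₁ h₂
    rw [hWv, Submodule.coe_eq_zero] at h₃
    ext j
    exact Fintype.linearIndependent_iff.1 b.linearIndependent x h₃ j
  obtain ⟨g, hg⟩ := LinearMap.exists_leftInverse_of_injective _ (LinearMap.ker_eq_bot.2 hinj)
  have hM : LinearMap.toMatrix' g * (C * W) = 1 := by
    apply Matrix.toLin'.injective
    rw [toLin'_mul, toLin'_toMatrix', toLin'_one, ← hg]
    rfl
  obtain ⟨f, hf⟩ := LinearMap.exists_leftInverse_of_injective V.mulVecLin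
    (LinearMap.ker_eq_bot.2 (mulVec_injective_iff.2 hV.1))
  have hU : LinearMap.toMatrix' f * V = 1 := by
    apply Matrix.toLin'.injective
    rw [toLin'_mul, toLin'_toMatrix', toLin'_one, ← hf]
    rfl
  have hCV : C * V = 0 := by
    refine Matrix.toLin'.injective (LinearMap.ext fun x => ?_)
    have : V.mulVecLin x ∈ LinearMap.ker C.mulVecLin := hker ▸ LinearMap.mem_range_self _ x
    simpa [mulVec_mulVec] using this
  obtain ⟨M, hMdef⟩ : ∃ M, M = LinearMap.toMatrix' g := ⟨_, rfl⟩
  obtain ⟨U, hUdef⟩ : ∃ U, U = LinearMap.toMatrix' f := ⟨_, rfl⟩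
  rw [← hMdef] at hM
  rw [← hUdef] at hU
  have hrange : ∀ y : Fin n → ℝ, ∃ x, (1 - W * (M * C)) *ᵥ y = V *ᵥ x := by
    intro y
    obtain ⟨k, hk, w, hw, rfl⟩ := Submodule.mem_sup.1 (hQ.sup_eq_top ▸ Submodule.mem_top (x := y))
    have hwW : W *ᵥ (b.repr ⟨w, hw⟩) = w := by rw [hWv, b.sum_repr]
    have hCk : C *ᵥ k = 0 := by simpa using hk
    rw [← hker] at hk
    obtain ⟨x, hx⟩ := hk
    refine ⟨x, ?_⟩
    have h₁ : (W * (M * C)) *ᵥ k = 0 := by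
      rw [← mulVec_mulVec, ← mulVec_mulVec, hCk, mulVec_zero, mulVec_zero]
    have h₂ : (W * (M * C)) *ᵥ w = w := by
      rw [← hwW, mulVec_mulVec, Matrix.mul_assoc, Matrix.mul_assoc, hM, Matrix.mul_one]
    rw [sub_mulVec, one_mulVec, mulVec_add, h₁, h₂, zero_add, add_sub_cancel_right]
    exact hx.symm
  -- An arbitrary left inverse of V need not vanish on the complement; composing it with the
  -- projection onto ker C corrects this.
  refine ⟨_, W, M, U * (1 - W * (M * C)), hCV, hM, ?_, ?_⟩
  · have : V * (U * (1 - W * (M * C))) = 1 - W * (M * C) := by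
      refine Matrix.toLin'.injective (LinearMap.ext fun y => ?_)
      obtain ⟨x, hx⟩ := hrange y
      rw [toLin'_apply, toLin'_apply, ← mulVec_mulVec, ← mulVec_mulVec, hx, mulVec_mulVec x U V,
        hU, one_mulVec]
    rw [this, sub_add_cancel]
  · rw [Matrix.mul_assoc, Matrix.sub_mul, Matrix.mul_assoc, Matrix.mul_assoc, hCV]
    simpa using hU

/-! ### Entrywise calculus of matrix functions on [0, T] -/

/-- Entrywise derivative within `[0, T]`. -/
def HasMDeriv {α β : Type*} (T : ℝ) (X : ℝ → Matrix α β ℝ) (X' : Matrix α β ℝ) (τ : ℝ) : Prop :=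
  ∀ i j, HasDerivWithinAt (fun t => X t i j) (X' i j) (Icc 0 T) τ

/-- Entrywise continuous differentiability on `[0, T]`. -/
def IsC1 {α β : Type*} (T : ℝ) (X : ℝ → Matrix α β ℝ) : Prop :=
  ∀ i j, ContDiffOn ℝ 1 (fun t => X t i j) (Icc 0 T)

section Calculus

variable {α β γ δ : Type*} {T τ : ℝ}

theorem HasMDeriv.mderiv_eq {X : ℝ → Matrix α β ℝ} {X' : Matrix α β ℝ} (h : HasMDeriv T X X' τ)
    (hT : 0 < T) (hτ : τ ∈ Icc 0 T) : mderiv T X τ = X' := by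
  ext i j
  exact (h i j).derivWithin (uniqueDiffOn_Icc hT τ hτ)

theorem IsC1.hasMDeriv {X : ℝ → Matrix α β ℝ} (h : IsC1 T X) (hτ : τ ∈ Icc 0 T) :
    HasMDeriv T X (mderiv T X τ) τ := fun i j =>
  (((h i j).differentiableOn one_ne_zero) τ hτ).hasDerivWithinAt

theorem HasMDeriv.mul [Fintype β] {X : ℝ → Matrix α β ℝ} {X' : Matrix α β ℝ}
    {Y : ℝ → Matrix β γ ℝ} {Y' : Matrix β γ ℝ} (hX : HasMDeriv T X X' τ)
    (hY : HasMDeriv T Y Y' τ) :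
    HasMDeriv T (fun t => X t * Y t) (X' * Y τ + X τ * Y') τ := by
  intro i j
  simp only [Matrix.mul_apply, Matrix.add_apply, ← Finset.sum_add_distrib]
  exact HasDerivWithinAt.fun_sum fun k _ => (hX i k).mul (hY k j)

theorem HasMDeriv.sub {X Y : ℝ → Matrix α β ℝ} {X' Y' : Matrix α β ℝ} (hX : HasMDeriv T X X' τ)
    (hY : HasMDeriv T Y Y' τ) : HasMDeriv T (fun t => X t - Y t) (X' - Y') τ :=
  fun i j => (hX i j).sub (hY i j)

theorem hasMDeriv_const (X : Matrix α β ℝ) : HasMDeriv T (fun _ => X) 0 τ :=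
  fun _ _ => hasDerivWithinAt_const ..

theorem HasMDeriv.fromBlocks {A : ℝ → Matrix α γ ℝ} {B : ℝ → Matrix α δ ℝ} {C : ℝ → Matrix β γ ℝ}
    {D : ℝ → Matrix β δ ℝ} {A' : Matrix α γ ℝ} {B' : Matrix α δ ℝ} {C' : Matrix β γ ℝ}
    {D' : Matrix β δ ℝ} (hA : HasMDeriv T A A' τ) (hB : HasMDeriv T B B' τ)
    (hC : HasMDeriv T C C' τ) (hD : HasMDeriv T D D' τ) :
    HasMDeriv T (fun t => Matrix.fromBlocks (A t) (B t) (C t) (D t))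
      (Matrix.fromBlocks A' B' C' D') τ := by
  rintro (i | i) (j | j)
  exacts [hA i j, hB i j, hC i j, hD i j]

theorem IsC1.mul [Fintype β] {X : ℝ → Matrix α β ℝ} {Y : ℝ → Matrix β γ ℝ} (hX : IsC1 T X)
    (hY : IsC1 T Y) : IsC1 T fun t => X t * Y t := by
  intro i j
  simp only [Matrix.mul_apply]
  exact ContDiffOn.sum fun k _ => (hX i k).mul (hY k j)

theorem IsC1.sub {X Y : ℝ → Matrix α β ℝ} (hX : IsC1 T X) (hY : IsC1 T Y) :
    IsC1 T fun t => X t - Y t :=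
  fun i j => (hX i j).sub (hY i j)

theorem isC1_const (X : Matrix α β ℝ) : IsC1 T fun _ => X := fun _ _ => contDiffOn_const

theorem IsC1.fromBlocks {A : ℝ → Matrix α γ ℝ} {B : ℝ → Matrix α δ ℝ} {C : ℝ → Matrix β γ ℝ}
    {D : ℝ → Matrix β δ ℝ} (hA : IsC1 T A) (hB : IsC1 T B) (hC : IsC1 T C) (hD : IsC1 T D) :
    IsC1 T fun t => Matrix.fromBlocks (A t) (B t) (C t) (D t) := by
  rintro (i | i) (j | j)
  exacts [hA i j, hB i j, hC i j, hD i j]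

theorem IsC1.det [Fintype α] [DecidableEq α] {X : ℝ → Matrix α α ℝ} (hX : IsC1 T X) :
    ContDiffOn ℝ 1 (fun t => (X t).det) (Icc 0 T) := by
  simp only [Matrix.det_apply]
  exact ContDiffOn.sum fun σ _ => (contDiffOn_prod fun i _ => hX (σ i) i).const_smul _

theorem IsC1.inv [Fintype α] [DecidableEq α] {X : ℝ → Matrix α α ℝ} (hX : IsC1 T X)
    (hu : ∀ t ∈ Icc 0 T, IsUnit (X t)) : IsC1 T fun t => (X t)⁻¹ := by
  intro i j
  simp only [Matrix.inv_def, Ring.inverse_eq_inv', Matrix.smul_apply, smul_eq_mul,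
    Matrix.adjugate_apply]
  refine (hX.det.inv fun t ht => ((isUnit_iff_isUnit_det _).1 (hu t ht)).ne_zero).mul ?_
  refine IsC1.det fun k l => ?_
  by_cases h : k = j
  · subst h
    simpa using contDiffOn_const
  · simpa [Matrix.updateRow_ne h] using hX k l

theorem IsC1.continuous_restrict {X : ℝ → Matrix α β ℝ} (hX : IsC1 T X) {s : Set ℝ}
    (hs : s ⊆ Icc 0 T) : Continuous fun t : s => X t :=
  continuous_matrix fun i j =>
    continuousOn_iff_continuous_domRestrict.1 ((hX i j).continuousOn.mono hs)

theorem IsC1.continuous_restrict_mderiv {X : ℝ → Matrix α β ℝ} (hX : IsC1 T X) (hT : 0 < T) :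
    Continuous fun t : Icc 0 T => mderiv T X t :=
  continuous_matrix fun i j => continuousOn_iff_continuous_domRestrict.1
    ((hX i j).continuousOn_derivWithin (uniqueDiffOn_Icc hT) le_rfl)

theorem mderiv_transpose_eq {X : ℝ → Matrix α α ℝ} (hX : IsC1Sym T X) (hτ : τ ∈ Icc 0 T) :
    (mderiv T X τ)ᵀ = mderiv T X τ := by
  ext i j
  exact derivWithin_congr (fun t ht => (congrFun₂ (hX.1 t ht) i j)) (congrFun₂ (hX.1 τ hτ) i j)

/-- Differentiate Z Z⁻¹ = 1 and multiply by Z⁻¹ from the left. -/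
theorem mderiv_inv_mul [Fintype α] [DecidableEq α] {Z : ℝ → Matrix α α ℝ} (hZ : IsC1 T Z)
    (hu : ∀ t ∈ Icc 0 T, IsUnit (Z t)) (hT : 0 < T) (hτ : τ ∈ Icc 0 T) :
    mderiv T (fun t => (Z t)⁻¹) τ = -((Z τ)⁻¹ * mderiv T Z τ * (Z τ)⁻¹) := by
  have h := (hZ.hasMDeriv hτ).mul ((hZ.inv hu).hasMDeriv hτ)
  have hone : ∀ t ∈ Icc 0 T, Z t * (Z t)⁻¹ = 1 := fun t ht =>
    mul_nonsing_inv _ ((isUnit_iff_isUnit_det _).1 (hu t ht))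
  have h₁ : HasMDeriv T (fun t => Z t * (Z t)⁻¹) 0 τ := fun i j =>
    (hasMDeriv_const (T := T) (τ := τ) (1 : Matrix α α ℝ) i j).congr
      (fun t ht => congrFun₂ (hone t ht) i j) (congrFun₂ (hone τ hτ) i j)
  have h₂ := (h.mderiv_eq hT hτ).symm.trans (h₁.mderiv_eq hT hτ)
  have h₃ : (Z τ)⁻¹ * Z τ = 1 := nonsing_inv_mul _ ((isUnit_iff_isUnit_det _).1 (hu τ hτ))
  have h₄ := congrArg ((Z τ)⁻¹ * ·) h₂
  simp only [Matrix.mul_add, ← Matrix.mul_assoc, h₃, Matrix.one_mul, Matrix.mul_zero] at h₄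
  exact (neg_eq_of_add_eq_zero_right h₄).symm

end Calculus

/-! ### Necessity: compressions of the certificate and of its inverse -/

section Necessity

theorem posDef_jump_primal {ν c n p q ρ : Type*} [Fintype ν] [Fintype c] [Fintype n] [Fintype p]
    [Fintype q] [Fintype ρ] [DecidableEq ρ] {E₁ : Matrix ν n ℝ} {E₂ : Matrix ν p ℝ}
    {V : Matrix ν ρ ℝ} {U : Matrix ρ ν ℝ} {C : Matrix q ν ℝ} (hCV : C * V = 0) (hUV : U * V = 1)
    {D : Matrix p q ℝ} {Cc : Matrix p c ℝ} {Bc : Matrix c q ℝ} {Ac : Matrix c c ℝ}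
    {A Z Z₀ : Matrix (ν ⊕ c) (ν ⊕ c) ℝ}
    (hA : A = fromBlocks (E₁ * E₁ᵀ + E₂ * D * C) (E₂ * Cc) (Bc * C) Ac)
    (h : (Z - Aᵀ * Z₀ * A).PosDef) :
    (Vᵀ * (Z.toBlocks₁₁ - E₁ * (E₁ᵀ * Z₀.toBlocks₁₁ * E₁) * E₁ᵀ) * V).PosDef := by
  obtain ⟨G, hG⟩ : ∃ G : Matrix (ν ⊕ c) ρ ℝ, G = fromRows V 0 := ⟨_, rfl⟩
  -- On (V, 0) every controller term of A carries a factor CV = 0.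
  have h₁ := h.transpose_mul_mul_of_leftInverse (G := G) (G' := fromCols U 0)
    (by simp [hG, fromCols_mul_fromRows, hUV])
  have hAG : A * G = fromRows (E₁ * (E₁ᵀ * V)) 0 := by
    rw [hA, hG]
    simp [fromBlocks_mul_fromRows, Matrix.add_mul, Matrix.mul_assoc, hCV]
  have e : Gᵀ * (Z - Aᵀ * Z₀ * A) * G = Gᵀ *
      (Z * G) - (A * G)ᵀ * (Z₀ * (A * G)) := by
    simp only [Matrix.mul_sub, Matrix.sub_mul, Matrix.transpose_mul, Matrix.mul_assoc]
  rw [e, hAG] at h₁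
  convert h₁ using 1
  rw [hG]
  conv_rhs => rw [← fromBlocks_toBlocks Z, ← fromBlocks_toBlocks Z₀]
  simp [transpose_fromRows, fromCols_mul_fromRows, fromBlocks_mul_fromRows, Matrix.mul_sub,
    Matrix.sub_mul, Matrix.mul_assoc]

variable {ν c : Type*} [Fintype ν] [Fintype c] [DecidableEq ν] [DecidableEq c]

/-- Congruence of the negated flow form by Z⁻¹; the first matrix argument is the derivative of Z⁻¹.
-/
theorem posDef_dualFlowForm_inv {A Z Z' : Matrix ν ν ℝ} (hZ : Z.PosDef)
    (h : NegDef (flowForm A Z' Z)) : (dualFlowForm A (-(Z⁻¹ * Z' * Z⁻¹)) Z⁻¹).PosDef := by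
  have hu := (isUnit_iff_isUnit_det _).1 hZ.isUnit
  have h₁ := Matrix.PosDef.transpose_mul_mul_of_leftInverse h (mul_nonsing_inv _ hu)
  convert h₁ using 1
  rw [hZ.inv.transpose_eq, flowForm_eq, dualFlowForm_eq]
  simp only [Matrix.mul_neg, Matrix.neg_mul, Matrix.mul_add, Matrix.add_mul, ← Matrix.mul_assoc,
    nonsing_inv_mul _ hu, Matrix.one_mul]
  simp only [Matrix.mul_assoc, mul_nonsing_inv _ hu, Matrix.mul_one]
  abel

/-- Both sides are Schur complements of the same matrix [[Z, Aᵀ], [A, Z₀⁻¹]]. -/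
theorem posDef_inv_sub_of_posDef_sub {A Z Z₀ : Matrix ν ν ℝ} (hZ : Z.PosDef) (hZ₀ : Z₀.PosDef)
    (h : (Z - Aᵀ * Z₀ * A).PosDef) : (Z₀⁻¹ - A * Z⁻¹ * Aᵀ).PosDef := by
  rw [← posDef_fromBlocks_iff₂₂ hZ]
  have h₁ : (fromBlocks Z Aᵀ Aᵀᵀ Z₀⁻¹).PosDef := by
    rw [posDef_fromBlocks_iff₂₂ hZ₀.inv,
      nonsing_inv_nonsing_inv _ ((isUnit_iff_isUnit_det _).1 hZ₀.isUnit)]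
    simpa using h
  simpa using h₁.submatrix (e := Sum.swap) Sum.swap_leftInverse.injective

theorem negDef_flowForm_toBlocks₁₁ {A : Matrix ν ν ℝ} {Ac : Matrix c c ℝ}
    {Z Z' : Matrix (ν ⊕ c) (ν ⊕ c) ℝ} (h : NegDef (flowForm (fromBlocks A 0 0 Ac) Z' Z)) :
    NegDef (flowForm A Z'.toBlocks₁₁ Z.toBlocks₁₁) := by
  have h₁ := Matrix.PosDef.toBlocks₁₁ h
  rw [NegDef]
  convert h₁ using 1
  rw [flowForm_eq, flowForm_eq]
  conv_rhs => rw [← fromBlocks_toBlocks Z, ← fromBlocks_toBlocks Z']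
  simp [fromBlocks_transpose, fromBlocks_multiply, fromBlocks_add, fromBlocks_neg]

theorem posDef_dualFlowForm_toBlocks₁₁ {A : Matrix ν ν ℝ} {Ac : Matrix c c ℝ}
    {Z Z' : Matrix (ν ⊕ c) (ν ⊕ c) ℝ} (h : (dualFlowForm (fromBlocks A 0 0 Ac) Z' Z).PosDef) :
    (dualFlowForm A Z'.toBlocks₁₁ Z.toBlocks₁₁).PosDef := by
  have h₁ := h.toBlocks₁₁
  convert h₁ using 1
  rw [dualFlowForm_eq, dualFlowForm_eq]
  conv_rhs => rw [← fromBlocks_toBlocks Z, ← fromBlocks_toBlocks Z']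
  simp [fromBlocks_transpose, fromBlocks_multiply, sub_eq_add_neg, fromBlocks_add, fromBlocks_neg]

/-- With Z₁₁ itself in the corner the matrix is a compression of diag(Z⁻¹) along (E, ZE), in general
only semidefinite. The second copy of Z₁₁ makes it strict. -/
theorem posDef_coupling {Z : Matrix (ν ⊕ c) (ν ⊕ c) ℝ} (hZ : Z.PosDef) :
    (fromBlocks Z⁻¹.toBlocks₁₁ 1 1 ((2 : ℝ) • Z.toBlocks₁₁)).PosDef := by
  have hu := (isUnit_iff_isUnit_det _).1 hZ.isUnit
  obtain ⟨E, hE⟩ : ∃ E : Matrix (ν ⊕ c) ν ℝ, E = fromRows 1 0 := ⟨_, rfl⟩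
  have hEE : Eᵀ * E = 1 := by
    rw [hE]; simp [transpose_fromRows, fromCols_mul_fromRows]
  have hc : ∀ S : Matrix (ν ⊕ c) (ν ⊕ c) ℝ, S.toBlocks₁₁ = Eᵀ * (S * E) := by
    intro S
    conv_rhs => rw [hE, ← fromBlocks_toBlocks S]
    simp [transpose_fromRows, fromCols_mul_fromRows, fromBlocks_mul_fromRows]
  have h := (hZ.inv.fromBlocks_diagonal hZ.toBlocks₁₁).transpose_mul_mul_of_leftInverse
    (G := fromBlocks E (Z * E) 0 1) (G' := fromBlocks Eᵀ (-(Eᵀ * (Z * E))) 0 1)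
    (by simp [fromBlocks_multiply, hEE])
  convert h using 1
  simp [fromBlocks_transpose, fromBlocks_multiply, hc, hZ.transpose_eq, Matrix.mul_assoc, hEE,
    mul_mul_cancel_of_mul_eq_one (nonsing_inv_mul Z hu),
    mul_mul_cancel_of_mul_eq_one (mul_nonsing_inv Z hu), two_smul]

variable {n p q : Type*} [Fintype n] [Fintype p] [Fintype q] [DecidableEq n]

theorem posDef_jump_dual {E₁ : Matrix ν n ℝ} {E₂ : Matrix ν p ℝ} (h₁₁ : E₁ᵀ * E₁ = 1)
    (h₂₁ : E₂ᵀ * E₁ = 0) {C : Matrix q ν ℝ}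
    {D : Matrix p q ℝ} {Cc : Matrix p c ℝ} {Bc : Matrix c q ℝ} {Ac : Matrix c c ℝ}
    {A Z Z₀ : Matrix (ν ⊕ c) (ν ⊕ c) ℝ}
    (hA : A = fromBlocks (E₁ * E₁ᵀ + E₂ * D * C) (E₂ * Cc) (Bc * C) Ac)
    (hZ : Z.PosDef) (hZ₀ : Z₀.PosDef) (h : (Z - Aᵀ * Z₀ * A).PosDef) :
    (E₁ᵀ * (Z₀⁻¹.toBlocks₁₁ - Z⁻¹.toBlocks₁₁) * E₁).PosDef := by
  obtain ⟨G, hG⟩ : ∃ G : Matrix (ν ⊕ c) n ℝ, G = fromRows E₁ 0 := ⟨_, rfl⟩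
  have h₁ := (posDef_inv_sub_of_posDef_sub hZ hZ₀ h).transpose_mul_mul_of_leftInverse
    (G := G) (G' := fromCols E₁ᵀ 0) (by simp [hG, fromCols_mul_fromRows, h₁₁])
  -- The controller reaches z at a jump only through E₂, and E₂ᵀE₁ = 0, so Aᵀ fixes (E₁, 0).
  have hAG : Aᵀ * G = G := by
    rw [hA, hG]
    simp [fromBlocks_transpose, fromBlocks_mul_fromRows, Matrix.add_mul, Matrix.mul_assoc, h₂₁,
      h₁₁]
  have e : Gᵀ * (Z₀⁻¹ - A * Z⁻¹ * Aᵀ) * G = Gᵀ *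
      (Z₀⁻¹ * G) - (Aᵀ * G)ᵀ * (Z⁻¹ * (Aᵀ * G)) := by
    simp only [Matrix.mul_sub, Matrix.sub_mul, Matrix.transpose_mul, Matrix.mul_assoc,
      transpose_transpose]
  rw [e, hAG] at h₁
  convert h₁ using 1
  rw [hG]
  conv_rhs => rw [← fromBlocks_toBlocks Z⁻¹, ← fromBlocks_toBlocks Z₀⁻¹]
  simp [transpose_fromRows, fromCols_mul_fromRows, fromBlocks_mul_fromRows, Matrix.mul_sub,
    Matrix.sub_mul, Matrix.mul_assoc]

end Necessity

/-! ### Invariance under relabelling of the state -/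

section Reindex

theorem ImpulsiveDesign.NegDef.submatrix_equiv {ν κ : Type*} {M : Matrix ν ν ℝ} (h : NegDef M)
    (e : κ ≃ ν) :
    NegDef (M.submatrix e e) := by
  have := Matrix.PosDef.submatrix h e.injective
  rwa [submatrix_neg] at this

variable {ν κ : Type*} [Fintype ν] [DecidableEq ν] [Fintype κ] [DecidableEq κ]

theorem flowForm_submatrix (e : κ ≃ ν) (A X' X : Matrix ν ν ℝ) :
    flowForm (A.submatrix e e) (X'.submatrix e e) (X.submatrix e e) =
      (flowForm A X' X).submatrix e e := by
  simp only [flowForm_eq, transpose_submatrix, submatrix_mul_equiv, submatrix_add, Pi.add_apply]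

theorem jumpForm_submatrix (e : κ ≃ ν) (A X X₀ : Matrix ν ν ℝ) :
    jumpForm (A.submatrix e e) (X.submatrix e e) (X₀.submatrix e e) =
      (jumpForm A X X₀).submatrix e e := by
  simp only [jumpForm_eq, transpose_submatrix, submatrix_mul_equiv, submatrix_neg, submatrix_sub,
    Pi.neg_apply, Pi.sub_apply]

theorem ImpulsiveDesign.IsCertificate.submatrix_equiv {Tmin Tmax : ℝ} {A AJ X : ℝ → Matrix ν ν ℝ}
    (h : IsCertificate Tmin Tmax A AJ X) (e : κ ≃ ν) :
    IsCertificate Tmin Tmax (fun t => (A t).submatrix e e) (fun t => (AJ t).submatrix e e)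
      (fun t => (X t).submatrix e e) where
  c1 := ⟨fun τ hτ => (h.c1.1 τ hτ).submatrix e, fun i j => h.c1.2 (e i) (e j)⟩
  pos τ hτ := (h.pos τ hτ).submatrix e.injective
  flow τ hτ := by
    have := (h.flow τ hτ).submatrix_equiv e
    rwa [← flowForm_submatrix] at this
  jump τ hτ := by
    have := (h.jump τ hτ).submatrix_equiv e
    rwa [← jumpForm_submatrix] at this

end Reindex

/-- The controller order may be indexed by any finite type. -/
theorem existsCertifiedController_of_fintype {n m l mJ lJ c : Type*} [Fintype n] [DecidableEq n]
    [Fintype m] [Fintype l] [Fintype mJ] [Fintype lJ] [Fintype c] [DecidableEq c] {Tmin Tmax : ℝ}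
    {P : Plant n m l mJ lJ} (K : Controller c m l mJ lJ) (hK : K.IsContinuous Tmin Tmax)
    {X : ℝ → Matrix (n ⊕ c) (n ⊕ c) ℝ} (hX : IsCertificate Tmin Tmax (clFlow P K) (clJump P K) X) :
    ExistsCertifiedController Tmin Tmax P := by
  let e := (Fintype.equivFin c).symm
  let K' : Controller (Fin (Fintype.card c)) m l mJ lJ :=
    { A := fun t => (K.A t).submatrix e e
      B := fun t => (K.B t).submatrix e id
      C := fun t => (K.C t).submatrix id e
      D := K.D
      AJ := fun t => (K.AJ t).submatrix e e
      BJ := fun t => (K.BJ t).submatrix e id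
      CJ := fun t => (K.CJ t).submatrix id e
      DJ := K.DJ }
  let f := Equiv.sumCongr (Equiv.refl n) e
  refine ⟨_, K', ?_, fun t => (X t).submatrix f f, ?_⟩
  · exact
      { A := (continuous_id.matrix_submatrix e e).comp_continuousOn hK.A
        B := (continuous_id.matrix_submatrix e id).comp_continuousOn hK.B
        C := (continuous_id.matrix_submatrix id e).comp_continuousOn hK.C
        D := hK.D
        AJ := (continuous_id.matrix_submatrix e e).comp_continuousOn hK.AJ
        BJ := (continuous_id.matrix_submatrix e id).comp_continuousOn hK.BJ
        CJ := (continuous_id.matrix_submatrix id e).comp_continuousOn hK.CJ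
        DJ := hK.DJ }
  · have h := hX.submatrix_equiv f
    convert h using 1
    · ext t (i | i) (j | j) <;> simp [clFlow, K', f, Matrix.mul_apply]
    · ext t (i | i) (j | j) <;> simp [clJump, K', f, Matrix.mul_apply]

/-! ### The sampled-data plant in terms of the coordinate embeddings -/

section SampledData

/-- The embedding of the left summand. -/
def inclLeft (n p : Type*) [DecidableEq n] : Matrix (n ⊕ p) n ℝ := fromRows 1 0

/-- The embedding of the right summand. -/
def inclRight (n p : Type*) [DecidableEq p] : Matrix (n ⊕ p) p ℝ := fromRows 0 1

/-- The output matrix `(C 0)`. -/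
def outputLeft (p : Type*) {n q : Type*} (C : Matrix q n ℝ) : Matrix q (n ⊕ p) ℝ := fromCols C 0

theorem clFlow_sampledDataPlant {n p q c m l : Type*} [Fintype m] [Fintype l] [DecidableEq n]
    [DecidableEq p]
    (A : Matrix n n ℝ) (B : Matrix n p ℝ) (CJ : Matrix q n ℝ) (K : Controller c m l p q) (τ : ℝ) :
    clFlow (sampledDataPlant m l A B CJ) K τ = fromBlocks (hatA A B) 0 0 (K.A τ) := by
  simp [clFlow, sampledDataPlant]

variable {n p q c m l : Type*} [Fintype n]

theorem inclLeft_mul_transpose [DecidableEq n] :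
    inclLeft n p * (inclLeft n p)ᵀ = fromBlocks 1 0 0 0 := by
  simp [inclLeft, transpose_fromRows, fromCols_fromRows_zero]

theorem clJump_sampledDataPlant [Fintype p] [Fintype q] [DecidableEq n] [DecidableEq p]
    (A : Matrix n n ℝ) (B : Matrix n p ℝ) (CJ : Matrix q n ℝ) (K : Controller c m l p q)
    (τ : ℝ) : clJump (sampledDataPlant m l A B CJ) K τ =
      fromBlocks (inclLeft n p * (inclLeft n p)ᵀ + inclRight n p * K.DJ τ * outputLeft p CJ)
        (inclRight n p * K.CJ τ) (K.BJ τ * outputLeft p CJ) (K.AJ τ) := by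
  rw [inclLeft_mul_transpose]
  rfl

theorem inclLeft_transpose_mul_self [Fintype p] [DecidableEq n] :
    (inclLeft n p)ᵀ * inclLeft n p = 1 := by
  simp [inclLeft, transpose_fromRows, fromCols_mul_fromRows]

theorem inclRight_transpose_mul_self [Fintype p] [DecidableEq p] :
    (inclRight n p)ᵀ * inclRight n p = 1 := by
  simp [inclRight, transpose_fromRows, fromCols_mul_fromRows]

theorem inclRight_transpose_mul_inclLeft [Fintype p] [DecidableEq n] [DecidableEq p] :
    (inclRight n p)ᵀ * inclLeft n p = 0 := by
  simp [inclLeft, inclRight, transpose_fromRows, fromCols_mul_fromRows]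

theorem inclLeft_add_inclRight [Fintype p] [DecidableEq n] [DecidableEq p] :
    inclLeft n p * (inclLeft n p)ᵀ + inclRight n p * (inclRight n p)ᵀ = 1 := by
  simp [inclLeft, inclRight, transpose_fromRows, fromCols_fromRows_zero, fromCols_zero_fromRows,
    fromBlocks_add]

theorem inclLeft_compression [Fintype p] [DecidableEq n] (S : Matrix (n ⊕ p) (n ⊕ p) ℝ) :
    (inclLeft n p)ᵀ * S * inclLeft n p = S.toBlocks₁₁ := by
  conv_lhs => rw [← fromBlocks_toBlocks S]
  simp [inclLeft, transpose_fromRows, fromCols_mul_fromRows, fromCols_mul_fromBlocks]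

theorem inclLeft_dilation [DecidableEq n] (S : Matrix n n ℝ) :
    inclLeft n p * S * (inclLeft n p)ᵀ = fromBlocks S 0 0 0 := by
  simp [inclLeft, transpose_fromRows, fromCols_fromRows_zero, fromRows_mul]

end SampledData

/-! ### Assembly of both implications -/

theorem IsCertificate.exists_primal_dual {n p q r nc m l : ℕ} {Tmin Tmax : ℝ} (hTmin : 0 < Tmin)
    (hT : Tmin < Tmax) {A : Matrix (Fin n) (Fin n) ℝ} {B : Matrix (Fin n) (Fin p) ℝ}
    {CJ : Matrix (Fin q) (Fin n) ℝ} {VJ : Matrix (Fin n) (Fin r) ℝ} {U : Matrix (Fin r) (Fin n) ℝ}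
    (hCV : CJ * VJ = 0) (hUV : U * VJ = 1)
    {K : Controller (Fin nc) (Fin m) (Fin l) (Fin p) (Fin q)}
    {Z : ℝ → Matrix ((Fin n ⊕ Fin p) ⊕ Fin nc) ((Fin n ⊕ Fin p) ⊕ Fin nc) ℝ}
    (hZ : IsCertificate Tmin Tmax (clFlow (sampledDataPlant (Fin m) (Fin l) A B CJ) K)
      (clJump (sampledDataPlant (Fin m) (Fin l) A B CJ) K) Z) :
    ∃ X Y : ℝ → Matrix (Fin n ⊕ Fin p) (Fin n ⊕ Fin p) ℝ,
        IsC1Sym Tmax X ∧ IsC1Sym Tmax Y ∧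
        (∀ τ ∈ Icc 0 Tmax,
          (fromBlocks (Y τ) 1 1 (X τ)).PosDef ∧
          NegDef (flowForm (hatA A B)
            (mderiv Tmax X τ) (X τ)) ∧
          (dualFlowForm (hatA A B)
            (mderiv Tmax Y τ) (Y τ)).PosDef) ∧
        (∀ τ ∈ Icc Tmin Tmax,
          NegDef
            ((fromBlocks VJ 0 0 (1 : Matrix (Fin p) (Fin p) ℝ))ᵀ *
              (fromBlocks (X 0).toBlocks₁₁ 0 0 0 - X τ) *
              fromBlocks VJ 0 0 (1 : Matrix (Fin p) (Fin p) ℝ)) ∧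
          ((Y 0).toBlocks₁₁ - (Y τ).toBlocks₁₁).PosDef) := by
  have hTmax : 0 < Tmax := hTmin.trans hT
  have hsub : Icc Tmin Tmax ⊆ Icc 0 Tmax := Icc_subset_Icc_left hTmin.le
  have h0 : (0 : ℝ) ∈ Icc 0 Tmax := ⟨le_rfl, hTmax.le⟩
  have hZ1 : IsC1 Tmax Z := hZ.c1.2
  have hu : ∀ t ∈ Icc 0 Tmax, IsUnit (Z t) := fun t ht => (hZ.pos t ht).isUnit
  -- The factor 2 buys strict coupling and costs nothing elsewhere, the other inequalities on X
  -- being homogeneous in X.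
  refine ⟨fun t => (2 : ℝ) • (Z t).toBlocks₁₁, fun t => (Z t)⁻¹.toBlocks₁₁, ⟨?_, ?_⟩, ⟨?_, ?_⟩,
    fun τ hτ => ⟨posDef_coupling (hZ.pos τ hτ), ?_, ?_⟩, fun τ hτ => ⟨?_, ?_⟩⟩
  · intro τ hτ
    exact Matrix.IsSymm.smul (hZ.pos τ hτ).toBlocks₁₁.transpose_eq _
  · intro i j
    exact (hZ.c1.2 (Sum.inl i) (Sum.inl j)).const_smul (2 : ℝ)
  · intro τ hτ
    exact (hZ.pos τ hτ).inv.toBlocks₁₁.transpose_eq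
  · intro i j
    exact hZ1.inv hu (Sum.inl i) (Sum.inl j)
  · have h := hZ.flow τ hτ
    rw [clFlow_sampledDataPlant] at h
    have h₁ := Matrix.PosDef.smul (negDef_flowForm_toBlocks₁₁ h) (two_pos (α := ℝ))
    have hd : mderiv Tmax (fun t => (2 : ℝ) • (Z t).toBlocks₁₁) τ
        = (2 : ℝ) • (mderiv Tmax Z τ).toBlocks₁₁ :=
      HasMDeriv.mderiv_eq (fun i j => (hZ1.hasMDeriv hτ (Sum.inl i) (Sum.inl j)).const_smul (2 : ℝ))
        hTmax hτ
    rw [NegDef]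
    convert h₁ using 1
    rw [hd, flowForm_eq, flowForm_eq]
    simp [smul_add]
  · have h := hZ.flow τ hτ
    rw [clFlow_sampledDataPlant] at h
    have h₁ := posDef_dualFlowForm_inv (hZ.pos τ hτ) h
    rw [← mderiv_inv_mul hZ1 hu hTmax hτ] at h₁
    have h₂ := posDef_dualFlowForm_toBlocks₁₁ h₁
    have hd : mderiv Tmax (fun t => (Z t)⁻¹.toBlocks₁₁) τ =
        (mderiv Tmax (fun t => (Z t)⁻¹) τ).toBlocks₁₁ := by
      ext i j
      rfl
    rwa [← hd] at h₂
  · have h := (negDef_jumpForm_iff _ _ _).1 (hZ.jump τ hτ)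
    have h₁ := posDef_jump_primal (C := outputLeft (Fin p) CJ)
      (V := fromBlocks VJ 0 0 (1 : Matrix (Fin p) (Fin p) ℝ))
      (U := fromBlocks U 0 0 (1 : Matrix (Fin p) (Fin p) ℝ)) (by simp [outputLeft, fromCols_mul_fromBlocks, hCV])
      (by simp [fromBlocks_multiply, hUV]) (clJump_sampledDataPlant A B CJ K τ) h
    have h₂ := h₁.smul (two_pos (α := ℝ))
    rw [inclLeft_compression, inclLeft_dilation] at h₂
    rw [NegDef]
    convert h₂ using 1
    have e : fromBlocks ((2 : ℝ) • (Z 0).toBlocks₁₁).toBlocks₁₁ 0 0 0 =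
        (2 : ℝ) • fromBlocks (Z 0).toBlocks₁₁.toBlocks₁₁ (0 : Matrix (Fin n) (Fin p) ℝ)
          (0 : Matrix (Fin p) (Fin n) ℝ) (0 : Matrix (Fin p) (Fin p) ℝ) := by
      rw [fromBlocks_smul, smul_zero, smul_zero, smul_zero]
      rfl
    rw [e, ← smul_sub, ← Matrix.neg_mul, ← Matrix.mul_neg, ← smul_neg, neg_sub, Matrix.mul_smul,
      Matrix.smul_mul]
  · have h := (negDef_jumpForm_iff _ _ _).1 (hZ.jump τ hτ)
    have h₁ := posDef_jump_dual inclLeft_transpose_mul_self inclRight_transpose_mul_inclLeft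
      (clJump_sampledDataPlant A B CJ K τ)
      (hZ.pos τ (hsub hτ)) (hZ.pos 0 h0) h
    rwa [inclLeft_compression] at h₁

section ClosedLoopDerivative

variable {ν : Type*} [Fintype ν] [DecidableEq ν] {T τ : ℝ} {X Y : ℝ → Matrix ν ν ℝ}

theorem IsC1.closedLoopLyapunov (hX : IsC1 T X) (hY : IsC1 T Y) :
    IsC1 T fun t => closedLoopLyapunov (X t) (Y t) :=
  hX.fromBlocks ((isC1_const 1).sub (hX.mul hY)) ((isC1_const 1).sub (hY.mul hX))
    (((hY.mul hX).mul hY).sub hY)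

theorem mderiv_closedLoopLyapunov (hX : IsC1 T X) (hY : IsC1 T Y) (hT : 0 < T)
    (hτ : τ ∈ Icc 0 T) :
    mderiv T (fun t => closedLoopLyapunov (X t) (Y t)) τ =
      fromBlocks (mderiv T X τ) (-(mderiv T X τ * Y τ + X τ * mderiv T Y τ))
        (-(mderiv T Y τ * X τ + Y τ * mderiv T X τ))
        (mderiv T Y τ * X τ * Y τ + Y τ * mderiv T X τ * Y τ + Y τ * X τ * mderiv T Y τ -
          mderiv T Y τ) := by
  have dX := hX.hasMDeriv hτ
  have dY := hY.hasMDeriv hτ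
  have h := dX.fromBlocks ((hasMDeriv_const 1).sub (dX.mul dY))
    ((hasMDeriv_const 1).sub (dY.mul dX)) (((dY.mul dX).mul dY).sub dY)
  have h₁ := h.mderiv_eq hT hτ
  simp only [zero_sub, Matrix.add_mul] at h₁
  exact h₁

end ClosedLoopDerivative

theorem existsCertifiedController_of_primal_dual {n p q r m l : ℕ} {Tmin Tmax : ℝ}
    (hTmin : 0 < Tmin) (hT : Tmin < Tmax) {A : Matrix (Fin n) (Fin n) ℝ}
    {B : Matrix (Fin n) (Fin p) ℝ} {CJ : Matrix (Fin q) (Fin n) ℝ} {VJ : Matrix (Fin n) (Fin r) ℝ}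
    (hVJ : IsKerBasis CJ VJ) {X Y : ℝ → Matrix (Fin n ⊕ Fin p) (Fin n ⊕ Fin p) ℝ}
    (hX : IsC1Sym Tmax X) (hY : IsC1Sym Tmax Y)
    (hS : ∀ τ ∈ Icc 0 Tmax, (fromBlocks (Y τ) 1 1 (X τ)).PosDef)
    (hfX : ∀ τ ∈ Icc 0 Tmax, NegDef (flowForm (hatA A B) (mderiv Tmax X τ) (X τ)))
    (hfY : ∀ τ ∈ Icc 0 Tmax, (dualFlowForm (hatA A B) (mderiv Tmax Y τ) (Y τ)).PosDef)
    (hjX : ∀ τ ∈ Icc Tmin Tmax, NegDef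
      ((fromBlocks VJ 0 0 (1 : Matrix (Fin p) (Fin p) ℝ))ᵀ *
        (fromBlocks (X 0).toBlocks₁₁ 0 0 0 - X τ) *
        fromBlocks VJ 0 0 (1 : Matrix (Fin p) (Fin p) ℝ)))
    (hjY : ∀ τ ∈ Icc Tmin Tmax, ((Y 0).toBlocks₁₁ - (Y τ).toBlocks₁₁).PosDef) :
    ExistsCertifiedController Tmin Tmax (sampledDataPlant (Fin m) (Fin l) A B CJ) := by
  have hTmax : 0 < Tmax := hTmin.trans hT
  have hsub : Icc Tmin Tmax ⊆ Icc 0 Tmax := Icc_subset_Icc_left hTmin.le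
  have h0 : (0 : ℝ) ∈ Icc 0 Tmax := ⟨le_rfl, hTmax.le⟩
  have hX1 : IsC1 Tmax X := hX.2
  have hY1 : IsC1 Tmax Y := hY.2
  obtain ⟨s, W₀, M, U₀, hCV₀, hMCW₀, hVU₀, hUV₀⟩ := exists_kernel_complement hVJ
  obtain ⟨V, hV⟩ : ∃ V : Matrix (Fin n ⊕ Fin p) (Fin r ⊕ Fin p) ℝ, V = fromBlocks VJ 0 0 1 :=
    ⟨_, rfl⟩
  obtain ⟨U, hU⟩ : ∃ U : Matrix (Fin r ⊕ Fin p) (Fin n ⊕ Fin p) ℝ, U = fromBlocks U₀ 0 0 1 :=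
    ⟨_, rfl⟩
  obtain ⟨W, hW⟩ : ∃ W : Matrix (Fin n ⊕ Fin p) (Fin s) ℝ, W = fromRows W₀ 0 := ⟨_, rfl⟩
  obtain ⟨C, hC⟩ : ∃ C, C = outputLeft (Fin p) CJ := ⟨_, rfl⟩
  obtain ⟨E₁, hE₁⟩ : ∃ E₁, E₁ = inclLeft (Fin n) (Fin p) := ⟨_, rfl⟩
  obtain ⟨E₂, hE₂⟩ : ∃ E₂, E₂ = inclRight (Fin n) (Fin p) := ⟨_, rfl⟩
  have h₁₁ : E₁ᵀ * E₁ = 1 := hE₁ ▸ inclLeft_transpose_mul_self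
  have h₂₂ : E₂ᵀ * E₂ = 1 := hE₂ ▸ inclRight_transpose_mul_self
  have h₂₁ : E₂ᵀ * E₁ = 0 := hE₁ ▸ hE₂ ▸ inclRight_transpose_mul_inclLeft
  have hE : E₁ * E₁ᵀ + E₂ * E₂ᵀ = 1 := hE₁ ▸ hE₂ ▸ inclLeft_add_inclRight
  have hCV : C * V = 0 := by
    rw [hC, hV]; simp [outputLeft, fromCols_mul_fromBlocks, hCV₀]
  have hUV : U * V = 1 := by
    rw [hU, hV]; simp [fromBlocks_multiply, hUV₀]
  have hMCW : M * (C * W) = 1 := by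
    rw [hC, hW]; simp [outputLeft, fromCols_mul_fromRows, hMCW₀]
  have hVU : V * U + W * (M * C) = 1 := by
    rw [hC, hW, hV, hU]
    simp [outputLeft, fromBlocks_multiply, mul_fromCols, fromRows_mul, fromCols_fromRows_zero,
      fromBlocks_add, hVU₀]
  have hVpos : ∀ τ ∈ Icc Tmin Tmax,
      (Vᵀ * (X τ - E₁ * (E₁ᵀ * X 0 * E₁) * E₁ᵀ) * V).PosDef := by
    intro τ hτ
    have h := hjX τ hτ
    rw [NegDef, ← Matrix.neg_mul, ← Matrix.mul_neg, neg_sub, ← hV] at h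
    rwa [hE₁, inclLeft_compression, inclLeft_dilation]
  have hYpos : ∀ τ ∈ Icc Tmin Tmax, (E₁ᵀ * (Y 0 - Y τ) * E₁).PosDef := by
    intro τ hτ
    rw [hE₁, inclLeft_compression]
    exact hjY τ hτ
  obtain ⟨Λ, hΛ⟩ : ∃ Λ : ℝ → Matrix ((Fin n ⊕ Fin p) ⊕ Fin p) (Fin s ⊕ (Fin n ⊕ Fin p)) ℝ,
      ∀ τ, Λ τ = jumpCompletion E₁ E₂ V W (X τ) (Y τ) (X 0) (Y 0) := ⟨_, fun _ => rfl⟩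
  have hcX : Continuous fun t : Icc Tmin Tmax => X t := hX1.continuous_restrict hsub
  have hcY : Continuous fun t : Icc Tmin Tmax => Y t := hY1.continuous_restrict hsub
  have hcΛ : Continuous fun t : Icc Tmin Tmax => Λ t := by
    simp only [hΛ]
    exact continuous_jumpCompletion E₁ E₂ V W (X 0) (Y 0) hcX hcY fun t =>
      (posDef_jumpCompletion_pivot hUV (hS t (hsub t.2)) (hYpos t t.2)).isUnit
  obtain ⟨hcA, hcB, hcC, hcD⟩ := continuous_jump_maps E₁ E₂ W M C (X 0) (Y 0) hcY hcΛ
  -- The flow input and output of the plant are zero, so B, C, D may be zero; A is the solution of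
  -- the cancellation equation in `negDef_flowForm_closedLoop`.
  let K : Controller (Fin n ⊕ Fin p) (Fin m) (Fin l) (Fin p) (Fin q) :=
    { A := fun t => (1 - X t * Y t)⁻¹ *
        (X t * mderiv Tmax Y t - X t * hatA A B * Y t - (hatA A B)ᵀ)
      B := 0
      C := 0
      D := 0
      AJ := fun t => jumpA E₁ E₂ W M C (Y t) (X 0) (Y 0) (Λ t)
      BJ := fun t => jumpB E₁ E₂ W M (X 0) (Y 0) (Λ t)
      CJ := fun t => jumpC M C (Y t) (Λ t)
      DJ := fun t => (Λ t).toBlocks₂₁ * M }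
  refine existsCertifiedController_of_fintype K
    { A := ?_
      B := continuousOn_const
      C := continuousOn_const
      D := continuousOn_const
      AJ := continuousOn_iff_continuous_domRestrict.2 hcA
      BJ := continuousOn_iff_continuous_domRestrict.2 hcB
      CJ := continuousOn_iff_continuous_domRestrict.2 hcC
      DJ := continuousOn_iff_continuous_domRestrict.2 hcD }
    (X := fun t => closedLoopLyapunov (X t) (Y t))
    { c1 := ⟨fun τ hτ => closedLoopLyapunov_transpose (hX.1 τ hτ) (hY.1 τ hτ),
        hX1.closedLoopLyapunov hY1⟩
      pos := fun τ hτ => posDef_closedLoopLyapunov (hS τ hτ)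
      flow := fun τ hτ => ?_
      jump := fun τ hτ => ?_ }
  · rw [continuousOn_iff_continuous_domRestrict]
    have cX : Continuous fun t : Icc 0 Tmax => X t := hX1.continuous_restrict subset_rfl
    have cY : Continuous fun t : Icc 0 Tmax => Y t := hY1.continuous_restrict subset_rfl
    have cY' : Continuous fun t : Icc 0 Tmax => mderiv Tmax Y t :=
      hY1.continuous_restrict_mderiv hTmax
    have cI : Continuous fun t : Icc 0 Tmax => (1 - X t * Y t)⁻¹ :=
      Continuous.matrix_inv_of_isUnit (continuous_const.sub (cX.matrix_mul cY))
        fun t => isUnit_one_sub_mul (hS t t.2)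
    exact cI.matrix_mul (((cX.matrix_mul cY').sub ((cX.matrix_mul continuous_const).matrix_mul
      cY)).sub continuous_const)
  · rw [clFlow_sampledDataPlant, mderiv_closedLoopLyapunov hX1 hY1 hTmax hτ]
    refine negDef_flowForm_closedLoop (hX.1 τ hτ) (hY.1 τ hτ) (mderiv_transpose_eq hY hτ)
      (hfX τ hτ) (hfY τ hτ) ?_
    exact mul_nonsing_inv_cancel_left _ _
      ((isUnit_iff_isUnit_det _).1 (isUnit_one_sub_mul (hS τ hτ)))
  · rw [negDef_jumpForm_iff]
    refine posDef_closedLoop_jump h₁₁ h₂₂ h₂₁ hE hCV hUV hMCW hVU (hS τ (hsub hτ)) (hS 0 h0)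
      (hVpos τ hτ) (hYpos τ hτ) (hΛ τ) ?_
    rw [clJump_sampledDataPlant, ← hE₁, ← hE₂, ← hC]

theorem corollary1 (n p q r m l : ℕ) (Tmin Tmax : ℝ) (hTmin : 0 < Tmin) (hT : Tmin < Tmax)
    (A : Matrix (Fin n) (Fin n) ℝ) (B : Matrix (Fin n) (Fin p) ℝ) (CJ : Matrix (Fin q) (Fin n) ℝ)
    (VJ : Matrix (Fin n) (Fin r) ℝ) (hVJ : IsKerBasis CJ VJ) :
    ExistsCertifiedController Tmin Tmax
        (sampledDataPlant (Fin m) (Fin l) A B CJ) ↔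
      ∃ X Y : ℝ → Matrix (Fin n ⊕ Fin p) (Fin n ⊕ Fin p) ℝ,
        IsC1Sym Tmax X ∧ IsC1Sym Tmax Y ∧
        (∀ τ ∈ Icc 0 Tmax,
          (fromBlocks (Y τ) 1 1 (X τ)).PosDef ∧
          NegDef (flowForm (hatA A B)
            (mderiv Tmax X τ) (X τ)) ∧
          (dualFlowForm (hatA A B)
            (mderiv Tmax Y τ) (Y τ)).PosDef) ∧
        (∀ τ ∈ Icc Tmin Tmax,
          NegDef
            ((fromBlocks VJ 0 0 (1 : Matrix (Fin p) (Fin p) ℝ))ᵀ *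
              (fromBlocks (X 0).toBlocks₁₁ 0 0 0 - X τ) *
              fromBlocks VJ 0 0 (1 : Matrix (Fin p) (Fin p) ℝ)) ∧
          ((Y 0).toBlocks₁₁ - (Y τ).toBlocks₁₁).PosDef) := by
  constructor
  · rintro ⟨nc, K, -, Z, hZ⟩
    obtain ⟨s, W, M, U, hCV, -, -, hUV⟩ := exists_kernel_complement hVJ
    exact IsCertificate.exists_primal_dual hTmin hT hCV hUV hZ
  · rintro ⟨X, Y, hX, hY, hflow, hjump⟩
    exact existsCertifiedController_of_primal_dual hTmin hT hVJ hX hY (fun τ hτ => (hflow τ hτ).1)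
      (fun τ hτ => (hflow τ hτ).2.1) (fun τ hτ => (hflow τ hτ).2.2) (fun τ hτ => (hjump τ hτ).1)
      (fun τ hτ => (hjump τ hτ).2)
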